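/- All operators are complex $d\times d$ matrices, $d\in\mathbb N$. A state is a positive semi-definite (PSD) matrix of unit trace. A POVM is a finite family $(\Lambda_x)_{x\in\mathcal X}$ of PSD matrices with $\sum_x\Lambda_x=I$. For a state $\rho$, a PSD matrix $\sigma$ and $\alpha\in(0,1)\cup(1,\infty)$, the measured Rényi relative quasi-entropy is $$Q_\alpha^M(\rho\|\sigma):=\begin{cases}\inf_{\mathcal X,(\Lambda_x)_x}\sum_{x\in\mathcal X}\operatorname{Tr}[\Lambda_x\rho]^\alpha\operatorname{Tr}[\Lambda_x\sigma]^{1-\alpha}, & \alpha\in(0,1),\\ \sup_{\mathcal X,(\Lambda_x)_x}\sum_{x\in\mathcal X}\operatorname{Tr}[\Lambda_x\rho]^\alpha\operatorname{Tr}[\Lambda_x\sigma]^{1-\alpha}, & \alpha>1,\end{cases}$$ over all finite alphabets $\mathcal X$ and all POVMs. For $\alpha>1$ the sum is $+\infty$ if $\operatorname{Tr}[\Lambda_x\rho]>0=\operatorname{Tr}[\Lambda_x\sigma]$ for some $x$, and terms in which both traces vanish count as $0$; so $Q_\alpha^M$ takes values in $[0,\infty]$. For positive definite $X,Y$ and $t\in\mathbb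 R$, let $G_t(X,Y):=X^{1/2}\left(X^{-1/2}YX^{-1/2}\right)^tX^{1/2}$. In the inequalities below, $\geq$ and $\leq$ refer to the Loewner order, and $\omega,\theta>0$ means that $\omega,\theta$ are positive definite. **Proposition.** Let $\rho$ be a state and $\sigma$ a positive semi-definite operator. For $\alpha\in(0,1/2)$, $$Q_\alpha^M(\rho\|\sigma)=\inf_{\omega,\theta>0}\left\{\alpha\operatorname{Tr}[\omega\rho]+(1-\alpha)\operatorname{Tr}[\theta\sigma]:\theta\geq G_{\frac{\alpha}{\alpha-1}}(I,\omega)\right\},$$ for $\alpha\in[1/2,1)$, $$Q_\alpha^M(\rho\|\sigma)=\inf_{\omega,\theta>0}\left\{\alpha\operatorname{Tr}[\theta\rho]+(1-\alpha)\operatorname{Tr}[\omega\sigma]:\theta\geq G_{1-\frac1\alpha}(I,\omega)\right\},$$ and for $\alpha>1$, $$Q_\alpha^M(\rho\|\sigma)=\sup_{\omega,\theta>0}\left\{\alpha\operatorname{Tr}[\theta\rho]+(1-\alpha)\operatorname{Tr}[\omega\sigma]:\theta\leq G_{1-\frac1\alpha}(I,\omega)\right\}$$ (both sides may be $+\infty$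 for $\alpha>1$). Moreover, for all rational $\alpha\in(0,1)\cup(1,\infty)$, $Q_\alpha^M(\rho\|\sigma)$ is the optimal value of a semi-definite program with $O(\log_2 q)$ linear matrix inequalities, each of size $2d\times 2d$. More precisely, there is a universal constant $C$ such that the following holds. Let $\alpha\in(0,1)\cup(1,\infty)$ be rational, let $p,q$ be relatively prime integers, $q\geq1$, with $\frac pq=\frac{\alpha}{\alpha-1}$ if $\alpha\in(0,1/2)$ and $\frac pq=1-\frac1\alpha$ if $\alpha\in[1/2,1)\cup(1,\infty)$, and let $d\in\mathbb N$. Then there are $N,m\in\mathbb N$ with $m\leq C(1+\log_2q)$, a system of $m$ linear matrix inequalities $$F^{(j)}_0+\sum_{i=1}^Ny_iF^{(j)}_i\geq0,\qquad j=1,\dots,m,$$ in real variables $y_1,\dots,y_N$ with Hermitian coefficient matrices of size $2d\times2d$, and Hermitian $d\times d$ matrices $A_1,\dots,A_N,B_1,\dots,B_N$, none of which depends on $\rho$ and $\sigma$, such that for every state $\rho$ and PSD matrix $\sigma$ of size $d\times d$, $Q_\alpha^M(\rho\|\sigma)$ is the infimum (if $\alpha<1$) or the supremum (if $\alpha>1$)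 of $$\sum_{i=1}^N\left(\alpha\operatorname{Tr}[A_i\rho]+(1-\alpha)\operatorname{Tr}[B_i\sigma]\right)y_i$$ over all $y\in\mathbb R^N$ that satisfy the system. -/

import Mathlib

open scoped ENNReal ComplexOrder

noncomputable section

/-- Square complex matrices of size `d`, the linear operators on a `d`-dimensional Hilbert space. -/
abbrev CMat (d : ℕ) : Type := Matrix (Fin d) (Fin d) ℂ

/-- A state (density operator): positive semi-definite with unit trace. -/
def IsState {d : ℕ} (ρ : CMat d) : Prop := ρ.PosSemidef ∧ ρ.trace = 1

/-- The trace pairing `Tr[A B]`, which is a real number when `A` and `B` are Hermitian. -/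
def trProd {d : ℕ} (A B : CMat d) : ℝ := (A * B).trace.re

/-- The real power of a Hermitian matrix through its functional calculus; used for positive
definite matrices, for which every real exponent makes sense. -/
def matPow {d : ℕ} (A : CMat d) (t : ℝ) : CMat d := cfc (fun x : ℝ => x ^ t) A

/-- The weighted geometric mean
`G_t(X, Y) = X^{1/2} (X^{-1/2} Y X^{-1/2})^t X^{1/2}` of positive definite `X`, `Y`. -/
def geoMean {d : ℕ} (t : ℝ) (X Y : CMat d) : CMat d :=
  matPow X (1 / 2) * matPow (matPow X (-(1 / 2)) * Y * matPow X (-(1 / 2))) t * matPow X (1 / 2)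

/-- A positive operator-valued measure with alphabet `Fin k`. -/
def IsPOVM {d k : ℕ} (Λ : Fin k → CMat d) : Prop :=
  (∀ x, (Λ x).PosSemidef) ∧ ∑ x, Λ x = 1

/-- `∑ₓ p(x)^α q(x)^{1-α}` for non-negative `p`, `q`, with values in `[0, ∞]`. For `α > 1` the
conventions of `ℝ≥0∞` make a term with `p(x) > 0 = q(x)` equal to `∞` and a term with
`p(x) = q(x) = 0` equal to `0`, so that the sum is infinite exactly when the support of `p` is not
contained in that of `q`. -/
def classicalQuasi {k : ℕ} (α : ℝ) (p q : Fin k → ℝ) : ℝ≥0∞ :=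
  ∑ x, ENNReal.ofReal (p x) ^ α * ENNReal.ofReal (q x) ^ (1 - α)

/-- The measured Rényi relative quasi-entropy `Q_α^M(ρ‖σ)`: the infimum (for `α < 1`) or the
supremum (for `α > 1`) of the classical quantity over all finite alphabets and all POVMs. -/
def measuredQuasi {d : ℕ} (α : ℝ) (ρ σ : CMat d) : ℝ≥0∞ :=
  if α < 1 then
    ⨅ (k : ℕ) (Λ : Fin k → CMat d) (_ : IsPOVM Λ),
      classicalQuasi α (fun x => trProd (Λ x) ρ) (fun x => trProd (Λ x) σ)
  else
    ⨆ (k : ℕ) (Λ : Fin k → CMat d) (_ : IsPOVM Λ),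
      classicalQuasi α (fun x => trProd (Λ x) ρ) (fun x => trProd (Λ x) σ)

/-- A system of `m` linear matrix inequalities in `N` real variables `y`, with Hermitian coefficient
matrices indexed by `ι`: the `j`-th inequality is `F₀ j + ∑ᵢ yᵢ F j i ≥ 0`. -/
structure LMISystem (N m : ℕ) (ι : Type) where
  /-- the constant terms -/
  F₀ : Fin m → Matrix ι ι ℂ
  /-- the coefficients of the variables -/
  F : Fin m → Fin N → Matrix ι ι ℂ
  isHermitian_F₀ : ∀ j, (F₀ j).IsHermitian
  isHermitian_F : ∀ j i, (F j i).IsHermitian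

namespace LMISystem

/-- The points at which all the linear matrix inequalities hold. -/
def feasible {N m : ℕ} {ι : Type} (S : LMISystem N m ι) : Set (Fin N → ℝ) :=
  {y | ∀ j, (S.F₀ j + ∑ i, (y i : ℂ) • S.F j i).PosSemidef}

/-- The optimal value of the semi-definite program that minimizes `∑ᵢ cᵢ yᵢ`. -/
def minValue {N m : ℕ} {ι : Type} (S : LMISystem N m ι) (c : Fin N → ℝ) : EReal :=
  ⨅ y ∈ S.feasible, ((∑ i, c i * y i : ℝ) : EReal)

/-- The optimal value of the semi-definite program that maximizes `∑ᵢ cᵢ yᵢ`. -/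
def maxValue {N m : ℕ} {ι : Type} (S : LMISystem N m ι) (c : Fin N → ℝ) : EReal :=
  ⨆ y ∈ S.feasible, ((∑ i, c i * y i : ℝ) : EReal)

end LMISystem

end

/-!
Two facts carry the variational formulas. For a positive definite `ω` with spectral measurement
`Λ`, Young's inequality for the eigenvalues compares the objective at `ω` with the classical
quantity of `Λ` (`measuredQuasi_le_of_posDef`, `le_measuredQuasi_of_posDef`). Conversely, for any
measurement `Λ`, choose scalars `cₓ` that are nearly optimal in Young's inequality for each outcome
and put `ω = ∑ₓ cₓ Λₓ`; Jensen's inequality for the operator convex (or concave) function `x ↦ x ^ t`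
bounds `ω ^ t` by `∑ₓ cₓ ^ t Λₓ`. This works for `t ∈ [-1, 1]`, hence directly for `α ≤ 1 / 2` and
`α > 1`; exchanging the two arguments exchanges `α` and `1 - α` and covers `1 / 2 ≤ α < 1`.

The semidefinite programs have one matrix variable `v e` for each of finitely many real exponents
`e`, to be thought of as the power `(v 1) ^ e`, and inequalities
`[[v a, v ((a + c) / 2)], [v ((a + c) / 2), v c]] ≥ 0` (`PowerSystem`). All of them hold for
the actual powers of a positive definite matrix, so only the converse matters: suitable lists of
`O(log q)` pairs `(a, c)` force `v (p / q) ≤ (v 1) ^ (p / q)` (`powerBound_div`). Dyadic exponents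
are reached by repeated midpoints. A general denominator `q` comes from the pair of exponents of
`T ^ r` and `U`, whose midpoint is `T` itself: this forces `T ^ (2 - r) ≤ U`, thus
`T ≤ U ^ (1 / (2 - r))`, and `1 / (2 - r) = 2 ^ l / q` for a suitable dyadic `r`.
The pair `(s, -s)`, with midpoint `v 0 = 1`, reaches negative exponents.

The same inequalities prove Jensen's inequality. They are satisfied by `v e = ∑ₓ cₓ ^ e Λₓ`, a sum
of positive matrices tensored with positive `2 × 2` scalar matrices, which gives the dyadic
exponents; continuity gives the others.
-/

section MatrixPowers

open scoped MatrixOrder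
open Filter Topology

variable {d : ℕ}

/-! ### Real powers of positive matrices -/

lemma le_iff_posSemidef {A B : CMat d} : A ≤ B ↔ (B - A).PosSemidef := Iff.rfl

lemma zero_le_iff_posSemidef {A : CMat d} : 0 ≤ A ↔ A.PosSemidef := by
  rw [le_iff_posSemidef, sub_zero]

lemma continuousOn_spectrum (A : CMat d) (f : ℝ → ℝ) : ContinuousOn f (spectrum ℝ A) :=
  A.finite_real_spectrum.continuousOn f

lemma spectrum_nonneg {A : CMat d} (hA : A.PosSemidef) {x : ℝ} (hx : x ∈ spectrum ℝ A) : 0 ≤ x := by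
  rw [hA.1.spectrum_real_eq_range_eigenvalues] at hx
  obtain ⟨i, rfl⟩ := hx
  exact hA.eigenvalues_nonneg i

lemma spectrum_pos {A : CMat d} (hA : A.PosDef) {x : ℝ} (hx : x ∈ spectrum ℝ A) : 0 < x := by
  rw [hA.1.spectrum_real_eq_range_eigenvalues] at hx
  obtain ⟨i, rfl⟩ := hx
  exact hA.eigenvalues_pos i

lemma isHermitian_matPow (A : CMat d) (s : ℝ) : (matPow A s).IsHermitian :=
  cfc_predicate (R := ℝ) (p := IsSelfAdjoint) _ A

lemma posSemidef_matPow {A : CMat d} (hA : A.PosSemidef) (s : ℝ) : (matPow A s).PosSemidef :=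
  zero_le_iff_posSemidef.1
    (cfc_nonneg fun _ hx => Real.rpow_nonneg (spectrum_nonneg hA hx) _)

lemma matPow_zero {A : CMat d} (hA : A.IsHermitian) : matPow A 0 = 1 := by
  simp only [matPow, Real.rpow_zero]
  exact cfc_const_one ℝ A hA

lemma matPow_one {A : CMat d} (hA : A.IsHermitian) : matPow A 1 = A := by
  simp only [matPow, Real.rpow_one]
  exact cfc_id' ℝ A hA

lemma one_matPow (s : ℝ) : matPow (1 : CMat d) s = 1 := by
  simp [matPow]

lemma matPow_add {A : CMat d} (hA : A.PosDef) (s t : ℝ) :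
    matPow A (s + t) = matPow A s * matPow A t := by
  unfold matPow
  rw [← cfc_mul _ _ A (continuousOn_spectrum A _) (continuousOn_spectrum A _)]
  exact cfc_congr fun x hx => Real.rpow_add (spectrum_pos hA hx) _ _

lemma matPow_add_of_nonneg {A : CMat d} (hA : A.PosSemidef) {s t : ℝ} (hs : 0 ≤ s) (ht : 0 ≤ t) :
    matPow A (s + t) = matPow A s * matPow A t := by
  unfold matPow
  rw [← cfc_mul _ _ A (continuousOn_spectrum A _) (continuousOn_spectrum A _)]
  exact cfc_congr fun x hx => Real.rpow_add_of_nonneg (spectrum_nonneg hA hx) hs ht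

lemma matPow_matPow {A : CMat d} (hA : A.PosSemidef) (s t : ℝ) :
    matPow (matPow A s) t = matPow A (s * t) := by
  unfold matPow
  refine (cfc_comp' (fun x : ℝ => x ^ t) (fun x : ℝ => x ^ s) A
    ((A.finite_real_spectrum.image _).continuousOn _) (continuousOn_spectrum A _) hA.1).symm.trans ?_
  exact cfc_congr fun x hx => (Real.rpow_mul (spectrum_nonneg hA hx) _ _).symm

lemma matPow_mul_matPow_neg {A : CMat d} (hA : A.PosDef) (s : ℝ) :
    matPow A s * matPow A (-s) = 1 := by
  rw [← matPow_add hA, add_neg_cancel, matPow_zero hA.1]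

lemma inv_matPow {A : CMat d} (hA : A.PosDef) (s : ℝ) : (matPow A s)⁻¹ = matPow A (-s) :=
  Matrix.inv_eq_right_inv (matPow_mul_matPow_neg hA s)

lemma posDef_matPow {A : CMat d} (hA : A.PosDef) (s : ℝ) : (matPow A s).PosDef :=
  (posSemidef_matPow hA.posSemidef s).posDef_iff_isUnit.2
    ((Matrix.isUnit_iff_isUnit_det _).2
      (Matrix.isUnit_det_of_right_inverse (matPow_mul_matPow_neg hA s)))

/-- The functional calculus of a fixed Hermitian matrix is continuous with respect to pointwise
convergence of functions, because the spectrum is finite. -/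
lemma tendsto_cfc {ι : Type*} {l : Filter ι} {A : CMat d} (hA : A.IsHermitian) {f : ι → ℝ → ℝ}
    {g : ℝ → ℝ} (h : ∀ x ∈ spectrum ℝ A, Tendsto (fun i => f i x) l (𝓝 (g x))) :
    Tendsto (fun i => cfc (f i) A) l (𝓝 (cfc g A)) := by
  simp only [hA.cfc_eq, Matrix.IsHermitian.cfc, Unitary.conjStarAlgAut_apply]
  refine (Tendsto.mul tendsto_const_nhds ?_).mul tendsto_const_nhds
  have hc : Continuous fun w : Fin d → ℂ => Matrix.diagonal w := by fun_prop
  refine (hc.tendsto _).comp (tendsto_pi_nhds.2 fun j => ?_)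
  exact (Complex.continuous_ofReal.tendsto _).comp (h _ (hA.eigenvalues_mem_spectrum_real j))

lemma posDef_add_smul_one {A : CMat d} (hA : A.PosSemidef) {ε : ℝ} (hε : 0 < ε) :
    (A + ε • (1 : CMat d)).PosDef :=
  Matrix.PosDef.posSemidef_add hA (Matrix.PosDef.one.smul hε)

lemma matPow_add_smul_one {A : CMat d} (hA : A.PosSemidef) (ε s : ℝ) :
    matPow (A + ε • (1 : CMat d)) s = cfc (fun x : ℝ => (x + ε) ^ s) A := by
  have h : A + ε • (1 : CMat d) = cfc (fun x : ℝ => x + ε) A := by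
    refine Eq.trans ?_
      (cfc_add_const ε (fun x : ℝ => x) A (continuousOn_spectrum A _) hA.1).symm
    rw [Algebra.algebraMap_eq_smul_one]
    exact congrArg (· + ε • (1 : CMat d)) (cfc_id' ℝ A hA.1).symm
  rw [h]
  exact (cfc_comp' (fun x : ℝ => x ^ s) (fun x : ℝ => x + ε) A
    ((A.finite_real_spectrum.image _).continuousOn _) (continuousOn_spectrum A _) hA.1).symm

lemma tendsto_matPow_add_smul_one {A : CMat d} (hA : A.PosSemidef) {s : ℝ} (hs : 0 ≤ s) :
    Tendsto (fun ε : ℝ => matPow (A + ε • (1 : CMat d)) s) (𝓝[>] 0) (𝓝 (matPow A s)) := by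
  simp only [matPow_add_smul_one hA]
  refine tendsto_cfc hA.1 fun x _ => ?_
  have hc : Continuous fun ε : ℝ => (x + ε) ^ s :=
    (Real.continuous_rpow_const hs).comp (continuous_const.add continuous_id)
  simpa using (hc.tendsto 0).mono_left nhdsWithin_le_nhds

lemma tendsto_matPow_exponent {A : CMat d} (hA : A.PosDef) {ι : Type*} {l : Filter ι}
    {u : ι → ℝ} {s : ℝ} (hu : Tendsto u l (𝓝 s)) :
    Tendsto (fun i => matPow A (u i)) l (𝓝 (matPow A s)) :=
  tendsto_cfc hA.1 fun _ hx => 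
    ((Real.continuousAt_const_rpow (spectrum_pos hA hx).ne').tendsto).comp hu

lemma self_le_add_smul_one {A : CMat d} {ε : ℝ} (hε : 0 ≤ ε) : A ≤ A + ε • (1 : CMat d) := by
  rw [le_iff_posSemidef, add_sub_cancel_left]
  exact Matrix.PosSemidef.one.smul hε

section OperatorNorm

-- The C⋆-algebra norm gives access to operator monotonicity and to the closedness of the order.
open scoped Matrix.Norms.L2Operator

/-- The Löwner–Heinz theorem for matrices. -/
lemma matPow_le_matPow {A B : CMat d} (hA : 0 ≤ A) (hAB : A ≤ B) {s : ℝ} (h0 : 0 ≤ s)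
    (h1 : s ≤ 1) : matPow A s ≤ matPow B s := by
  have h := CFC.rpow_le_rpow (p := s) ⟨h0, h1⟩ hAB
  rwa [CFC.rpow_eq_cfc_real hA, CFC.rpow_eq_cfc_real (hA.trans hAB)] at h

/-- A Hermitian square root of a matrix below `U` is below the positive square root of `U`. -/
lemma le_matPow_half_of_sq_le {Z U : CMat d} (hZ : Z.IsHermitian) (h : Z * Z ≤ U) :
    Z ≤ matPow U (1 / 2) := by
  have hsq : (0 : CMat d) ≤ Z * Z := by
    have := Matrix.posSemidef_conjTranspose_mul_self Z
    rw [hZ.eq] at this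
    exact zero_le_iff_posSemidef.2 this
  have h1 : Z ≤ CFC.abs Z := by
    rw [← sub_nonneg, CFC.abs_sub_self Z hZ]
    exact nsmul_nonneg (CFC.negPart_nonneg Z) 2
  refine h1.trans ?_
  have h2 : CFC.abs Z = matPow (Z * Z) (1 / 2) := by
    rw [CFC.abs, CFC.sqrt_eq_rpow]
    have : star Z = Z := hZ
    rw [this, CFC.rpow_eq_cfc_real hsq]
    rfl
  rw [h2]
  exact matPow_le_matPow hsq h (by norm_num) (by norm_num)

lemma le_of_tendsto_matrix {ι : Type*} {l : Filter ι} [l.NeBot] {f g : ι → CMat d} {A B : CMat d}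
    (hf : Tendsto f l (𝓝 A)) (hg : Tendsto g l (𝓝 B)) (h : ∀ᶠ i in l, f i ≤ g i) : A ≤ B :=
  le_of_tendsto_of_tendsto hf hg h

end OperatorNorm

/-! ### Positive semidefinite block matrices -/

lemma block_mono {A A' B C C' : CMat d} (hA : A ≤ A') (hC : C ≤ C')
    (h : (Matrix.fromBlocks A B B C).PosSemidef) : (Matrix.fromBlocks A' B B C').PosSemidef := by
  have h1 : (Matrix.fromBlocks (A' - A) 0 0 (C' - C)).PosSemidef := by
    have hL := (le_iff_posSemidef.1 hA).mul_mul_conjTranspose_same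
      (Matrix.fromRows (1 : CMat d) (0 : CMat d))
    have hR := (le_iff_posSemidef.1 hC).mul_mul_conjTranspose_same
      (Matrix.fromRows (0 : CMat d) (1 : CMat d))
    rw [Matrix.conjTranspose_fromRows_eq_fromCols_conjTranspose, Matrix.fromRows_mul,
      Matrix.fromRows_mul_fromCols] at hL hR
    simpa [Matrix.fromBlocks_add] using hL.add hR
  simpa [Matrix.fromBlocks_add] using h1.add h

/-- The Schur complement criterion for blocks with Hermitian off-diagonal part. -/
lemma block_posSemidef_iff {A B C : CMat d} (hA : A.PosDef) (hB : B.IsHermitian) :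
    (Matrix.fromBlocks A B B C).PosSemidef ↔ B * A⁻¹ * B ≤ C := by
  let := hA.isUnit.invertible
  have h := Matrix.PosDef.fromBlocks₁₁ (A := A) B C hA
  rwa [hB.eq] at h

lemma conj_le_conj {A B : CMat d} (h : A ≤ B) {K : CMat d} (hK : K.IsHermitian) :
    K * A * K ≤ K * B * K := by
  have h1 := (le_iff_posSemidef.1 h).conjTranspose_mul_mul_same K
  rwa [hK.eq, mul_sub, sub_mul] at h1

/-- The geometric mean of two powers of `Y` is the largest off-diagonal block that keeps the block
matrix positive. -/
lemma le_matPow_of_block_matPow {Y Z : CMat d} (hY : Y.PosDef) (hZ : Z.IsHermitian) {a c : ℝ}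
    (h : (Matrix.fromBlocks (matPow Y a) Z Z (matPow Y c)).PosSemidef) :
    Z ≤ matPow Y ((a + c) / 2) := by
  rw [block_posSemidef_iff (posDef_matPow hY a) hZ, inv_matPow hY] at h
  set K := matPow Y (-(a / 2)) with hK
  have hKh : K.IsHermitian := isHermitian_matPow _ _
  have hKK : matPow Y (-a) = K * K := by rw [hK, ← matPow_add hY]; ring_nf
  have h1 : (K * Z * K) * (K * Z * K) ≤ matPow Y (c - a) := by
    have h2 := conj_le_conj h hKh
    have e : K * matPow Y c * K = matPow Y (c - a) := by
      rw [hK, ← matPow_add hY, ← matPow_add hY]; ring_nf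
    rw [hKK, e] at h2
    simpa only [mul_assoc] using h2
  have h3 := le_matPow_half_of_sq_le (by
    have := Matrix.isHermitian_conjTranspose_mul_mul K hZ
    rwa [hKh.eq] at this) h1
  rw [matPow_matPow hY.posSemidef] at h3
  have h4 := conj_le_conj h3 (isHermitian_matPow Y (a / 2))
  have hinv : matPow Y (a / 2) * K = 1 := matPow_mul_matPow_neg hY _
  have hinv' : K * matPow Y (a / 2) = 1 := by
    have := matPow_mul_matPow_neg hY (-(a / 2))
    rwa [neg_neg] at this
  have e1 : matPow Y (a / 2) * (K * Z * K) * matPow Y (a / 2) = Z := by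
    calc _ = (matPow Y (a / 2) * K) * Z * (K * matPow Y (a / 2)) := by simp only [mul_assoc]
      _ = Z := by rw [hinv, hinv', one_mul, mul_one]
  rw [e1, ← matPow_add hY, ← matPow_add hY] at h4
  convert h4 using 2
  ring

lemma le_matPow_of_block {X A C Z : CMat d} (hX : X.PosSemidef) (hZ : Z.IsHermitian) {a c : ℝ}
    (ha0 : 0 ≤ a) (ha1 : a ≤ 1) (hc0 : 0 ≤ c) (hc1 : c ≤ 1) (hA : A ≤ matPow X a)
    (hC : C ≤ matPow X c) (h : (Matrix.fromBlocks A Z Z C).PosSemidef) :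
    Z ≤ matPow X ((a + c) / 2) := by
  refine le_of_tendsto_matrix tendsto_const_nhds
    (tendsto_matPow_add_smul_one hX (by positivity)) ?_
  filter_upwards [self_mem_nhdsWithin] with ε hε
  have hXε : X ≤ X + ε • (1 : CMat d) := self_le_add_smul_one (le_of_lt hε)
  have hX0 : 0 ≤ X := zero_le_iff_posSemidef.2 hX
  exact le_matPow_of_block_matPow (posDef_add_smul_one hX hε) hZ
    (block_mono (hA.trans (matPow_le_matPow hX0 hXε ha0 ha1))
      (hC.trans (matPow_le_matPow hX0 hXε hc0 hc1)) h)

/-- The Schur complement of `T ^ r` in a block matrix with off-diagonal part `T`; it needs no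
inverse, since `T (T ^ r)⁻¹ T` is replaced by `T ^ (2 - r)`. -/
lemma matPow_le_of_block {T W U : CMat d} (hT : T.PosSemidef) {r : ℝ} (hr0 : 0 ≤ r) (hr1 : r ≤ 1)
    (hW : W ≤ matPow T r) (h : (Matrix.fromBlocks W T T U).PosSemidef) :
    matPow T (2 - r) ≤ U := by
  have h1 := block_mono hW le_rfl h
  set K := matPow T (1 - r) with hK
  have hKh : K.IsHermitian := isHermitian_matPow _ _
  -- Evaluate the block form on the vectors `(-T ^ (1 - r) x, x)`.
  have h2 := h1.conjTranspose_mul_mul_same (Matrix.fromRows (-K) (1 : CMat d))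
  have e1 : T * K = matPow T (2 - r) := by
    have := matPow_add_of_nonneg hT zero_le_one (sub_nonneg.2 hr1)
    rw [matPow_one hT.1] at this
    rw [hK, ← this]; ring_nf
  have e2 : K * T = matPow T (2 - r) := by
    have := matPow_add_of_nonneg hT (sub_nonneg.2 hr1) zero_le_one
    rw [matPow_one hT.1] at this
    rw [hK, ← this]; ring_nf
  have e3 : matPow T r * K = T := by
    rw [hK, ← matPow_add_of_nonneg hT hr0 (sub_nonneg.2 hr1)]
    ring_nf
    exact matPow_one hT.1
  rw [Matrix.conjTranspose_fromRows_eq_fromCols_conjTranspose, Matrix.mul_assoc,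
    Matrix.fromBlocks_mul_fromRows, Matrix.fromCols_mul_fromRows] at h2
  simp only [Matrix.conjTranspose_neg, hKh.eq, Matrix.conjTranspose_one, mul_neg, mul_one, one_mul,
    e1, e3, neg_mul, mul_add, e2] at h2
  rw [le_iff_posSemidef]
  convert h2 using 1
  abel

/-- Powers of a positive definite matrix form positive block matrices. -/
lemma block_matPow {X : CMat d} (hX : X.PosDef) (a c : ℝ) :
    (Matrix.fromBlocks (matPow X a) (matPow X ((a + c) / 2)) (matPow X ((a + c) / 2))
      (matPow X c)).PosSemidef := by
  rw [block_posSemidef_iff (posDef_matPow hX a) (isHermitian_matPow _ _), inv_matPow hX,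
    ← matPow_add hX, ← matPow_add hX]
  refine le_of_eq ?_
  congr 1
  ring

end MatrixPowers

section PowerSystems

open scoped MatrixOrder
open Filter Topology

variable {d : ℕ}

/-! ### Linear matrix inequalities between powers -/

/-- A family of Hermitian matrices indexed by real exponents, `v e` standing for the `e`-th power of
`v 1`, that is normalized by `v 0 = 1` and satisfies one linear matrix inequality of size
`2d × 2d` for each pair `(a, c)` of the list `L`: the block matrix with diagonal `v a`, `v c` and
off-diagonal part `v ((a + c) / 2)` is positive. -/
structure PowerSystem (L : List (ℝ × ℝ)) (v : ℝ → CMat d) : Prop where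
  zero_eq_one : v 0 = 1
  isHermitian : ∀ e, (v e).IsHermitian
  block : ∀ ac ∈ L, (Matrix.fromBlocks (v ac.1) (v ((ac.1 + ac.2) / 2)) (v ((ac.1 + ac.2) / 2))
    (v ac.2)).PosSemidef

lemma PowerSystem.mono {L L' : List (ℝ × ℝ)} {v : ℝ → CMat d} (h : PowerSystem L v)
    (hL : L' ⊆ L) : PowerSystem L' v :=
  ⟨h.zero_eq_one, h.isHermitian, fun ac hac => h.block ac (hL hac)⟩

/-- A pair `(a, a)` encodes positivity of `v a`. -/
lemma PowerSystem.posSemidef {L : List (ℝ × ℝ)} {v : ℝ → CMat d} (h : PowerSystem L v) {a : ℝ}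
    (ha : (a, a) ∈ L) : (v a).PosSemidef := by
  have h1 := (h.block _ ha).submatrix Sum.inl
  exact h1

lemma powerSystem_matPow (L : List (ℝ × ℝ)) {X : CMat d} (hX : X.PosDef) :
    PowerSystem L (matPow X) :=
  ⟨matPow_zero hX.1, isHermitian_matPow X, fun ac _ => block_matPow hX ac.1 ac.2⟩

/-- `n` linear matrix inequalities between powers suffice to bound the power of exponent `s`: from
any base exponent `b` they force `v (b s) ≤ (v b) ^ s`. The list of inequalities does not depend on
the dimension. -/
def PowerBound (s : ℝ) (n : ℕ) : Prop :=
  ∀ b : ℝ, ∃ L : List (ℝ × ℝ), L.length ≤ n ∧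
    ∀ (d : ℕ) (v : ℝ → CMat d), PowerSystem L v → (v b).PosSemidef →
      v (b * s) ≤ matPow (v b) s

lemma PowerBound.mono {s : ℝ} {n m : ℕ} (h : PowerBound s n) (hnm : n ≤ m) : PowerBound s m :=
  fun b => (h b).imp fun _ hL => ⟨hL.1.trans hnm, hL.2⟩

lemma powerBound_zero : PowerBound 0 0 := fun b =>
  ⟨[], le_rfl, fun d v hv hb => by rw [mul_zero, hv.zero_eq_one, matPow_zero hb.1]⟩

lemma powerBound_one : PowerBound 1 0 := fun b =>
  ⟨[], le_rfl, fun d v hv hb => by rw [mul_one, matPow_one hb.1]⟩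

/-- One more inequality, for a geometric mean, passes to the midpoint of two exponents. -/
lemma PowerBound.midpoint {s t : ℝ} {n m : ℕ} (hs : PowerBound s n) (ht : PowerBound t m)
    (hs0 : 0 ≤ s) (hs1 : s ≤ 1) (ht0 : 0 ≤ t) (ht1 : t ≤ 1) :
    PowerBound ((s + t) / 2) (n + m + 1) := by
  intro b
  obtain ⟨L₁, hn, h₁⟩ := hs b
  obtain ⟨L₂, hm, h₂⟩ := ht b
  refine ⟨(b * s, b * t) :: (L₁ ++ L₂), by simp; omega, fun d v hv hb => ?_⟩
  have hblock := hv.block (b * s, b * t) (by simp)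
  have e : (b * s + b * t) / 2 = b * ((s + t) / 2) := by ring
  simp only [e] at hblock
  exact le_matPow_of_block hb (hv.isHermitian _) hs0 hs1 ht0 ht1
    (h₁ d v (hv.mono fun x hx => by simp [hx]) hb) (h₂ d v (hv.mono fun x hx => by simp [hx]) hb)
    hblock

/-- With `T = v (b u / (2 - r))`, the inequality for the pair of exponents of `T ^ r` and
`v (b u)` has `T` itself off the diagonal, so that it forces `T ^ (2 - r) ≤ v (b u)`. This is the
rule that produces denominators other than powers of two. -/
lemma PowerBound.div_two_sub {u r : ℝ} {n m : ℕ} (hu : PowerBound u n) (hr : PowerBound r m)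
    (hr0 : 0 ≤ r) (hr1 : r ≤ 1) : PowerBound (u / (2 - r)) (n + m + 2) := by
  intro b
  set w := u / (2 - r) with hw
  have hr2 : 2 - r ≠ 0 := by linarith
  obtain ⟨L₁, hn, h₁⟩ := hu b
  obtain ⟨L₂, hm, h₂⟩ := hr (b * w)
  refine ⟨(b * w, b * w) :: (b * w * r, b * u) :: (L₁ ++ L₂), by simp; omega, fun d v hv hb => ?_⟩
  have hT : (v (b * w)).PosSemidef := hv.posSemidef (by simp)
  have hblock := hv.block (b * w * r, b * u) (by simp)
  have e : (b * w * r + b * u) / 2 = b * w := by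
    rw [hw]; field_simp; ring
  simp only [e] at hblock
  have h := (matPow_le_of_block hT hr0 hr1
    (h₂ d v (hv.mono fun x hx => by simp [hx]) hT) hblock).trans
    (h₁ d v (hv.mono fun x hx => by simp [hx]) hb)
  have hexp : (2 - r) * (1 / (2 - r)) = 1 := by field_simp
  have h' := matPow_le_matPow (zero_le_iff_posSemidef.2 (posSemidef_matPow hT _)) h
    (s := 1 / (2 - r)) (one_div_nonneg.2 (by linarith))
    ((div_le_one (by linarith)).2 (by linarith))
  rw [matPow_matPow hT, matPow_matPow hb, hexp, matPow_one hT.1] at h'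
  rw [← div_eq_mul_one_div] at h'
  exact h'

lemma powerBound_dyadic (l p : ℕ) (hp : p ≤ 2 ^ l) : PowerBound ((p : ℝ) / 2 ^ l) l := by
  induction l generalizing p with
  | zero =>
    have : p = 0 ∨ p = 1 := by simp at hp; omega
    rcases this with rfl | rfl
    · simpa using powerBound_zero
    · simpa using powerBound_one
  | succ l ih =>
    rcases le_total p (2 ^ l) with h | h
    · have h1 : (p : ℝ) / 2 ^ l ≤ 1 := (div_le_one (by positivity)).2 (by exact_mod_cast h)
      have := powerBound_zero.midpoint (ih p h) le_rfl zero_le_one (by positivity) h1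
      convert this using 1
      · rw [pow_succ]; field_simp; ring
      · omega
    · have h2 : p - 2 ^ l ≤ 2 ^ l := by rw [pow_succ] at hp; omega
      have h1 : ((p - 2 ^ l : ℕ) : ℝ) / 2 ^ l ≤ 1 :=
        (div_le_one (by positivity)).2 (by exact_mod_cast h2)
      have := powerBound_one.midpoint (ih _ h2) zero_le_one le_rfl (by positivity) h1
      convert this using 1
      · rw [pow_succ, Nat.cast_sub h]; push_cast; field_simp; ring
      · omega

/-- If `2 ^ l ≤ q < 2 ^ (l + 1)`, the dyadic exponents `p / 2 ^ l` and
`r = (2 ^ (l + 1) - q) / 2 ^ l` combine to `(p / 2 ^ l) / (2 - r) = p / q`. -/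
lemma powerBound_div_of_le {l p q : ℕ} (hp : p ≤ 2 ^ l) (hq : 2 ^ l ≤ q) (hq' : q < 2 ^ (l + 1)) :
    PowerBound ((p : ℝ) / q) (2 * l + 2) := by
  have h2 : 2 ^ (l + 1) - q ≤ 2 ^ l := by rw [pow_succ] at *; omega
  have hr1 : ((2 ^ (l + 1) - q : ℕ) : ℝ) / 2 ^ l ≤ 1 :=
    (div_le_one (by positivity)).2 (by exact_mod_cast h2)
  have := (powerBound_dyadic l p hp).div_two_sub (powerBound_dyadic l _ h2) (by positivity) hr1
  have hq0 : (q : ℝ) ≠ 0 := by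
    have := Nat.two_pow_pos l
    exact_mod_cast (by omega : q ≠ 0)
  have e : (2 : ℝ) - ((2 ^ (l + 1) - q : ℕ) : ℝ) / 2 ^ l = q / 2 ^ l := by
    rw [Nat.cast_sub hq'.le]; push_cast; rw [pow_succ]; field_simp; ring
  rw [e] at this
  convert this using 1
  · field_simp
  · omega

/-- Exponents above `1 / 2` are midpoints of `1` and a smaller exponent, whose distance to `1` is
twice as large; `n` counts these doublings. -/
lemma powerBound_div_of_lt {l q : ℕ} (hq : 2 ^ l ≤ q) (hq' : q < 2 ^ (l + 1)) (n p : ℕ)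
    (hpq : p ≤ q) (hn : q ≤ 2 ^ n * (q - p)) : PowerBound ((p : ℝ) / q) (2 * l + 2 + n) := by
  have hq0 : 0 < q := (Nat.two_pow_pos l).trans_le hq
  have hqr : (0 : ℝ) < q := by exact_mod_cast hq0
  induction n generalizing p with
  | zero => exact powerBound_div_of_le (by simp at hn; omega) hq hq'
  | succ n ih =>
    rcases le_total p (2 ^ l) with h | h
    · exact (powerBound_div_of_le h hq hq').mono (by omega)
    · rw [pow_succ] at hq'
      have hp2 : 2 * p - q ≤ q := by omega
      have hle : ((2 * p - q : ℕ) : ℝ) / q ≤ 1 := (div_le_one hqr).2 (by exact_mod_cast hp2)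
      have e : q - (2 * p - q) = 2 * (q - p) := by omega
      have := powerBound_one.midpoint (ih (2 * p - q) hp2
        (by rw [e]; rw [pow_succ] at hn; linarith)) zero_le_one le_rfl (by positivity) hle
      convert this using 1
      · rw [Nat.cast_sub (by omega)]; push_cast; field_simp; ring
      · omega

lemma powerBound_div {p q : ℕ} (hq : 0 < q) (hpq : p ≤ q) :
    PowerBound ((p : ℝ) / q) (3 * Nat.log 2 q + 3) := by
  have h1 : 2 ^ Nat.log 2 q ≤ q := Nat.pow_log_le_self 2 hq.ne'
  have h2 : q < 2 ^ (Nat.log 2 q + 1) := Nat.lt_pow_succ_log_self (by norm_num) q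
  rcases hpq.eq_or_lt with rfl | hlt
  · have : (p : ℝ) / p = 1 := div_self (by exact_mod_cast hq.ne')
    rw [this]
    exact powerBound_one.mono (by omega)
  · refine (powerBound_div_of_lt h1 h2 (Nat.log 2 q + 1) p hpq ?_).mono (by omega)
    calc q ≤ 2 ^ (Nat.log 2 q + 1) * 1 := by omega
      _ ≤ _ := Nat.mul_le_mul_left _ (by omega)

/-! ### Jensen's inequality for measurements -/

lemma posSemidef_sum_smul {k : ℕ} {Λ : Fin k → CMat d} (hΛ : IsPOVM Λ) {c : Fin k → ℝ}
    (hc : ∀ x, 0 ≤ c x) : (∑ x, c x • Λ x).PosSemidef :=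
  Matrix.posSemidef_sum _ fun x _ => (hΛ.1 x).smul (hc x)

lemma posDef_sum_smul {k : ℕ} {Λ : Fin k → CMat d} (hΛ : IsPOVM Λ) {c : Fin k → ℝ}
    (hc : ∀ x, 0 < c x) : (∑ x, c x • Λ x).PosDef := by
  obtain ⟨m, hm0, hm⟩ : ∃ m : ℝ, 0 < m ∧ ∀ x, m ≤ c x := by
    rcases isEmpty_or_nonempty (Fin k) with h | h
    · exact ⟨1, one_pos, fun x => h.elim x⟩
    · obtain ⟨x₀, hx₀⟩ := Finite.exists_min c
      exact ⟨c x₀, hc x₀, hx₀⟩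
  have h := Matrix.PosDef.posSemidef_add
    (posSemidef_sum_smul hΛ (c := fun x => c x - m) fun x => sub_nonneg.2 (hm x))
    (Matrix.PosDef.one.smul hm0 : (m • (1 : CMat d)).PosDef)
  rw [← hΛ.2, Finset.smul_sum, ← Finset.sum_add_distrib] at h
  simpa [← add_smul] using h

/-- The moments `∑ₓ λₓ ^ e Λₓ` of a measurement satisfy every inequality between powers, because
the scalars `λₓ ^ e` do. -/
lemma powerSystem_povm (L : List (ℝ × ℝ)) {k : ℕ} {Λ : Fin k → CMat d} (hΛ : IsPOVM Λ)
    {c : Fin k → ℝ} (hc : ∀ x, 0 < c x) : PowerSystem L fun e => ∑ x, (c x ^ e) • Λ x where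
  zero_eq_one := by simp [hΛ.2]
  isHermitian e := (posSemidef_sum_smul hΛ fun x => Real.rpow_nonneg (hc x).le e).1
  block := by
    rintro ⟨a, b⟩ -
    have h : ∀ x, (Matrix.fromBlocks (c x ^ a • Λ x) (c x ^ ((a + b) / 2) • Λ x)
        (c x ^ ((a + b) / 2) • Λ x) (c x ^ b • Λ x)).PosSemidef := by
      intro x
      have h1 := (hΛ.1 x).mul_mul_conjTranspose_same
        (Matrix.fromRows (c x ^ (a / 2) • (1 : CMat d)) (c x ^ (b / 2) • (1 : CMat d)))
      rw [Matrix.conjTranspose_fromRows_eq_fromCols_conjTranspose, Matrix.fromRows_mul,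
        Matrix.fromRows_mul_fromCols] at h1
      simp only [Matrix.conjTranspose_smul, star_trivial, Matrix.conjTranspose_one,
        Matrix.smul_mul, Matrix.mul_smul, one_mul, mul_one, smul_smul,
        ← Real.rpow_add (hc x)] at h1
      convert h1 using 3 <;> ring_nf
    have h2 := Matrix.posSemidef_sum Finset.univ fun x _ => h x
    convert h2 using 1
    ext i j
    rcases i with i | i <;> rcases j with j | j <;> simp [Matrix.sum_apply]

/-- Operator concavity of the power functions, in the form of Jensen's inequality. -/
lemma sum_rpow_smul_le_matPow {k : ℕ} {Λ : Fin k → CMat d} (hΛ : IsPOVM Λ) {c : Fin k → ℝ}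
    (hc : ∀ x, 0 < c x) {s : ℝ} (hs0 : 0 ≤ s) (hs1 : s ≤ 1) :
    ∑ x, (c x ^ s) • Λ x ≤ matPow (∑ x, c x • Λ x) s := by
  -- Dyadic exponents are covered by the inequalities between powers; the rest is continuity.
  have hpd := posDef_sum_smul hΛ hc
  have hdy : ∀ l : ℕ, ∑ x, (c x ^ ((⌊s * 2 ^ l⌋₊ : ℝ) / 2 ^ l)) • Λ x ≤
      matPow (∑ x, c x • Λ x) ((⌊s * 2 ^ l⌋₊ : ℝ) / 2 ^ l) := by
    intro l
    have hle : ⌊s * 2 ^ l⌋₊ ≤ 2 ^ l := by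
      have h1 : s * 2 ^ l ≤ ((2 ^ l : ℕ) : ℝ) := by
        push_cast
        exact mul_le_of_le_one_left (by positivity) hs1
      exact (Nat.floor_le_floor h1).trans (Nat.floor_natCast _).le
    obtain ⟨L, -, hL⟩ := powerBound_dyadic l _ hle 1
    simpa using hL d _ (powerSystem_povm L hΛ hc) (by simpa using hpd.posSemidef)
  have hlim : Tendsto (fun l : ℕ => (⌊s * 2 ^ l⌋₊ : ℝ) / 2 ^ l) atTop (𝓝 s) :=
    (tendsto_nat_floor_mul_div_atTop (R := ℝ) hs0).comp
      (tendsto_pow_atTop_atTop_of_one_lt one_lt_two)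
  refine le_of_tendsto_matrix ?_ (tendsto_matPow_exponent hpd hlim) (Eventually.of_forall hdy)
  refine tendsto_finsetSum _ fun x _ => ?_
  exact (((Real.continuousAt_const_rpow (hc x).ne').tendsto).comp hlim).smul_const _

lemma matPow_neg_le_of_block {Y T θ : CMat d} (hY : Y.PosDef) {s : ℝ} (hT : T ≤ matPow Y s)
    (h : (Matrix.fromBlocks T 1 1 θ).PosSemidef) : matPow Y (-s) ≤ θ := by
  have h1 := (block_posSemidef_iff (posDef_matPow hY s) Matrix.isHermitian_one).1
    (block_mono hT le_rfl h)
  rwa [one_mul, mul_one, inv_matPow hY] at h1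

/-- Operator convexity of the power functions with exponents in `[-1, 0]`, in the form of Jensen's
inequality. -/
lemma matPow_neg_le_sum_rpow_smul {k : ℕ} {Λ : Fin k → CMat d} (hΛ : IsPOVM Λ) {c : Fin k → ℝ}
    (hc : ∀ x, 0 < c x) {s : ℝ} (hs0 : 0 ≤ s) (hs1 : s ≤ 1) :
    matPow (∑ x, c x • Λ x) (-s) ≤ ∑ x, (c x ^ (-s)) • Λ x := by
  have hsys := powerSystem_povm [(s, -s)] hΛ hc
  have hblock := hsys.block (s, -s) (by simp)
  have e : (s + -s) / 2 = 0 := by ring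
  have h0 := hsys.zero_eq_one
  simp only [e] at hblock
  beta_reduce at h0
  rw [h0] at hblock
  exact matPow_neg_le_of_block (posDef_sum_smul hΛ hc) (sum_rpow_smul_le_matPow hΛ hc hs0 hs1)
    hblock

end PowerSystems

section Variational

open scoped MatrixOrder
open Filter Topology

variable {d : ℕ}

/-! ### The trace pairing and spectral measurements -/

lemma trProd_add_left (A B C : CMat d) : trProd (A + B) C = trProd A C + trProd B C := by
  simp [trProd, add_mul]

lemma trProd_sub_left (A B C : CMat d) : trProd (A - B) C = trProd A C - trProd B C := by
  simp [trProd, sub_mul]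

lemma trProd_smul_left (r : ℝ) (A B : CMat d) : trProd (r • A) B = r * trProd A B := by
  simp [trProd]

lemma trProd_sum_left {ι : Type*} (s : Finset ι) (A : ι → CMat d) (B : CMat d) :
    trProd (∑ i ∈ s, A i) B = ∑ i ∈ s, trProd (A i) B := by
  simp [trProd, Finset.sum_mul, Matrix.trace_sum]

lemma trProd_nonneg {A B : CMat d} (hA : A.PosSemidef) (hB : B.PosSemidef) : 0 ≤ trProd A B := by
  set K := matPow A (1 / 2)
  have hK : K * K = A := by
    rw [← matPow_add_of_nonneg hA (by norm_num) (by norm_num)]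
    norm_num
    exact matPow_one hA.1
  have h := (hB.conjTranspose_mul_mul_same K).trace_nonneg
  rw [(isHermitian_matPow A _).eq, Matrix.mul_assoc, Matrix.trace_mul_comm, Matrix.mul_assoc,
    hK, Matrix.trace_mul_comm] at h
  exact (Complex.le_def.1 h).1

lemma trProd_mono_left {A B C : CMat d} (hAB : A ≤ B) (hC : C.PosSemidef) :
    trProd A C ≤ trProd B C := by
  rw [← sub_nonneg, ← trProd_sub_left]
  exact trProd_nonneg (le_iff_posSemidef.1 hAB) hC

/-- The spectral measurement of a Hermitian matrix: it diagonalizes the functional calculus. -/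
lemma exists_spectral_povm {A : CMat d} (hA : A.IsHermitian) :
    ∃ Λ : Fin d → CMat d, IsPOVM Λ ∧ ∀ f : ℝ → ℝ, cfc f A = ∑ i, f (hA.eigenvalues i) • Λ i := by
  set φ := Unitary.conjStarAlgAut ℂ (CMat d) hA.eigenvectorUnitary
  have hsum : ∀ g : Fin d → ℝ, φ (Matrix.diagonal fun i => (g i : ℂ)) =
      ∑ i, g i • φ (Matrix.diagonal (Pi.single i 1)) := by
    intro g
    have h : (Matrix.diagonal fun i => (g i : ℂ)) =
        ∑ i, (g i : ℂ) • Matrix.diagonal (Pi.single i (1 : ℂ)) := by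
      ext a b
      simp [Matrix.sum_apply, Matrix.diagonal_apply, Pi.single_apply]
    rw [h, map_sum]
    refine Finset.sum_congr rfl fun i _ => ?_
    rw [map_smul]
    exact Complex.coe_smul _ _
  refine ⟨fun i => φ (Matrix.diagonal (Pi.single i 1)), ⟨fun i => ?_, ?_⟩, fun f => ?_⟩
  · have h : (Matrix.diagonal (Pi.single i (1 : ℂ)) : CMat d).PosSemidef :=
      Matrix.PosSemidef.diagonal fun j => by
        rw [Pi.single_apply]; split_ifs <;> simp
    exact h.mul_mul_conjTranspose_same (hA.eigenvectorUnitary : CMat d)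
  · have h := hsum fun _ => 1
    simp only [one_smul] at h
    rw [← h]
    simp
  · rw [hA.cfc_eq]
    exact hsum fun i => f (hA.eigenvalues i)

/-! ### Scalar inequalities -/

lemma young_of_lt_one {α : ℝ} (h0 : 0 < α) (h1 : α < 1) {c p q : ℝ} (hc : 0 < c) (hp : 0 ≤ p)
    (hq : 0 ≤ q) :
    p ^ α * q ^ (1 - α) ≤ α * (c * p) + (1 - α) * (c ^ (α / (α - 1)) * q) := by
  have h := Real.geom_mean_le_arith_mean2_weighted (w₁ := α) (w₂ := 1 - α) h0.le (by linarith)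
    (mul_nonneg hc.le hp) (mul_nonneg (Real.rpow_nonneg hc.le (α / (α - 1))) hq) (by ring)
  refine le_trans (le_of_eq ?_) h
  rw [Real.mul_rpow hc.le hp, Real.mul_rpow (Real.rpow_nonneg hc.le _) hq, ← Real.rpow_mul hc.le]
  have e : α / (α - 1) * (1 - α) = -α := by
    have : α - 1 ≠ 0 := by linarith
    field_simp; ring
  rw [e, Real.rpow_neg hc.le]
  have : c ^ α ≠ 0 := (Real.rpow_pos_of_pos hc _).ne'
  field_simp

lemma exists_young_of_lt_one {α : ℝ} (h0 : 0 < α) (h1 : α < 1) {p q : ℝ} (hp : 0 ≤ p)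
    (hq : 0 ≤ q) {ε : ℝ} (hε : 0 < ε) :
    ∃ c : ℝ, 0 < c ∧
      α * (c * p) + (1 - α) * (c ^ (α / (α - 1)) * q) ≤ p ^ α * q ^ (1 - α) + ε := by
  have hneg : 0 < α / (1 - α) := div_pos h0 (by linarith)
  have e : α / (α - 1) = -(α / (1 - α)) := by rw [← div_neg, neg_sub]
  rcases hp.eq_or_lt with rfl | hp'
  · have hlim : Tendsto (fun c : ℝ => (1 - α) * (c ^ (-(α / (1 - α))) * q)) atTop (𝓝 0) := by
      simpa using ((tendsto_rpow_neg_atTop hneg).mul_const q).const_mul (1 - α)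
    obtain ⟨c, hc, hc0⟩ := ((hlim.eventually (gt_mem_nhds hε)).and (eventually_gt_atTop 0)).exists
    refine ⟨c, hc0, ?_⟩
    rw [e, Real.zero_rpow h0.ne']
    linarith
  rcases hq.eq_or_lt with rfl | hq'
  · refine ⟨ε / (α * p), by positivity, ?_⟩
    rw [Real.zero_rpow (by linarith : (1 - α) ≠ 0)]
    have : α * (ε / (α * p) * p) = ε := by field_simp
    linarith
  -- Equality in Young's inequality.
  · refine ⟨(q / p) ^ (1 - α), by positivity, ?_⟩
    have hr : 0 < q / p := by positivity
    have e1 : (q / p) ^ (1 - α) * p = p ^ α * q ^ (1 - α) := by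
      rw [Real.div_rpow hq hp, Real.rpow_sub hp', Real.rpow_one]
      have : p ^ α ≠ 0 := (Real.rpow_pos_of_pos hp' _).ne'
      field_simp
    have e2 : ((q / p) ^ (1 - α)) ^ (α / (α - 1)) * q = p ^ α * q ^ (1 - α) := by
      rw [← Real.rpow_mul hr.le]
      have : (1 - α) * (α / (α - 1)) = -α := by
        have : α - 1 ≠ 0 := by linarith
        field_simp; ring
      rw [this, Real.rpow_neg hr.le, Real.div_rpow hq hp, Real.rpow_sub hq', Real.rpow_one]
      have h2 : q ^ α ≠ 0 := (Real.rpow_pos_of_pos hq' _).ne'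
      field_simp
    rw [e1, e2]
    linarith

lemma young_of_one_lt {α : ℝ} (h1 : 1 < α) {c p q : ℝ} (hc : 0 < c) (hp : 0 ≤ p)
    (hq : 0 < q) :
    α * (c ^ (1 - 1 / α) * p) + (1 - α) * (c * q) ≤ p ^ α * q ^ (1 - α) := by
  have h0 : 0 < α := by linarith
  have hw : 0 ≤ 1 - 1 / α := sub_nonneg.2 ((div_le_one h0).2 h1.le)
  have h := Real.geom_mean_le_arith_mean2_weighted (w₁ := 1 / α) (w₂ := 1 - 1 / α)
    (by positivity) hw (p₁ := p ^ α * q ^ (1 - α)) (p₂ := c * q) (by positivity) (by positivity)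
    (by ring)
  have e : (p ^ α * q ^ (1 - α)) ^ (1 / α) * (c * q) ^ (1 - 1 / α) = c ^ (1 - 1 / α) * p := by
    rw [Real.mul_rpow (by positivity) (by positivity), Real.mul_rpow hc.le hq.le,
      ← Real.rpow_mul hp, ← Real.rpow_mul hq.le, mul_one_div_cancel h0.ne', Real.rpow_one]
    have e1 : (1 - α) * (1 / α) = -(1 - 1 / α) := by field_simp; ring
    rw [e1, Real.rpow_neg hq.le]
    have : q ^ (1 - 1 / α) ≠ 0 := (Real.rpow_pos_of_pos hq _).ne'
    field_simp
  rw [e] at h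
  have h2 := mul_le_mul_of_nonneg_left h h0.le
  have e3 : α * (1 / α * (p ^ α * q ^ (1 - α)) + (1 - 1 / α) * (c * q)) =
      p ^ α * q ^ (1 - α) + (α - 1) * (c * q) := by field_simp
  rw [e3] at h2
  linarith

lemma exists_young_of_one_lt {α : ℝ} (h1 : 1 < α) {p q : ℝ} (hp : 0 ≤ p)
    (hq : 0 ≤ q) (hpq : q = 0 → p = 0) {ε : ℝ} (hε : 0 < ε) :
    ∃ c : ℝ, 0 < c ∧
      p ^ α * q ^ (1 - α) - ε ≤ α * (c ^ (1 - 1 / α) * p) + (1 - α) * (c * q) := by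
  have h0 : 0 < α := by linarith
  rcases hq.eq_or_lt with rfl | hq'
  · refine ⟨1, one_pos, ?_⟩
    rw [hpq rfl, Real.zero_rpow h0.ne']
    linarith
  rcases hp.eq_or_lt with rfl | hp'
  · have hα : 0 < α - 1 := by linarith
    refine ⟨ε / ((α - 1) * q), by positivity, ?_⟩
    rw [Real.zero_rpow h0.ne']
    have : (α - 1) * (ε / ((α - 1) * q) * q) = ε := by field_simp
    linarith
  -- Equality in Young's inequality.
  · refine ⟨(p / q) ^ α, by positivity, ?_⟩
    have hr : 0 < p / q := by positivity
    have hqα : q ^ α ≠ 0 := (Real.rpow_pos_of_pos hq' _).ne'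
    have e1 : (p / q) ^ α * q = p ^ α * q ^ (1 - α) := by
      rw [Real.div_rpow hp hq, Real.rpow_sub hq', Real.rpow_one]
      field_simp
    have e2 : ((p / q) ^ α) ^ (1 - 1 / α) * p = p ^ α * q ^ (1 - α) := by
      rw [← Real.rpow_mul hr.le]
      have : α * (1 - 1 / α) = α - 1 := by field_simp
      rw [this, Real.rpow_sub hr, Real.rpow_one, Real.div_rpow hp hq, Real.rpow_sub hq',
        Real.rpow_one]
      field_simp
    rw [e1, e2]
    linarith

/-! ### Extended real bookkeeping -/

lemma tendsto_coe_add_mul (x K : ℝ) :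
    Tendsto (fun ε : ℝ => ((x + ε * K : ℝ) : EReal)) (𝓝[>] 0) (𝓝 (x : EReal)) := by
  have h : Continuous fun ε : ℝ => ((x + ε * K : ℝ) : EReal) :=
    continuous_coe_real_ereal.comp (by fun_prop)
  simpa using (h.tendsto 0).mono_left nhdsWithin_le_nhds

lemma le_coe_of_forall_pos {b : EReal} {x K : ℝ}
    (h : ∀ ε : ℝ, 0 < ε → b ≤ ((x + ε * K : ℝ) : EReal)) : b ≤ x :=
  ge_of_tendsto (tendsto_coe_add_mul x K) (eventually_mem_nhdsWithin.mono h)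

lemma coe_le_of_forall_pos {b : EReal} {x K : ℝ}
    (h : ∀ ε : ℝ, 0 < ε → ((x + ε * K : ℝ) : EReal) ≤ b) : (x : EReal) ≤ b :=
  le_of_tendsto (tendsto_coe_add_mul x K) (eventually_mem_nhdsWithin.mono h)

lemma measuredQuasi_le_classicalQuasi {α : ℝ} (h1 : α < 1) {ρ σ : CMat d} {k : ℕ}
    {Λ : Fin k → CMat d} (hΛ : IsPOVM Λ) : measuredQuasi α ρ σ ≤
      classicalQuasi α (fun x => trProd (Λ x) ρ) (fun x => trProd (Λ x) σ) := by
  rw [measuredQuasi, if_pos h1]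
  exact iInf_le_of_le k (iInf_le_of_le Λ (iInf_le _ hΛ))

lemma classicalQuasi_le_measuredQuasi {α : ℝ} (h1 : 1 < α) {ρ σ : CMat d} {k : ℕ}
    {Λ : Fin k → CMat d} (hΛ : IsPOVM Λ) :
    classicalQuasi α (fun x => trProd (Λ x) ρ) (fun x => trProd (Λ x) σ) ≤
      measuredQuasi α ρ σ := by
  rw [measuredQuasi, if_neg h1.not_gt]
  exact le_iSup_of_le k (le_iSup_of_le Λ (le_iSup_of_le hΛ le_rfl))

lemma le_measuredQuasi {α : ℝ} (h1 : α < 1) {ρ σ : CMat d} {b : EReal}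
    (h : ∀ (k : ℕ) (Λ : Fin k → CMat d), IsPOVM Λ →
      b ≤ (classicalQuasi α (fun x => trProd (Λ x) ρ) (fun x => trProd (Λ x) σ) : EReal)) :
    b ≤ (measuredQuasi α ρ σ : EReal) := by
  have hb : b ≤ (b.toENNReal : EReal) := by
    rcases le_total 0 b with hb | hb
    · rw [EReal.coe_toENNReal hb]
    · exact hb.trans (EReal.coe_ennreal_nonneg _)
  refine hb.trans (EReal.coe_ennreal_le_coe_ennreal_iff.2 ?_)
  rw [measuredQuasi, if_pos h1]
  refine le_iInf fun k => le_iInf fun Λ => le_iInf fun hΛ => ?_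
  simpa using EReal.toENNReal_le_toENNReal (h k Λ hΛ)

lemma isPOVM_one : IsPOVM fun _ : Fin 1 => (1 : CMat d) :=
  ⟨fun _ => Matrix.PosSemidef.one, by simp⟩

lemma measuredQuasi_le {α : ℝ} (h1 : 1 < α) {ρ σ : CMat d} {b : EReal}
    (h : ∀ (k : ℕ) (Λ : Fin k → CMat d), IsPOVM Λ →
      (classicalQuasi α (fun x => trProd (Λ x) ρ) (fun x => trProd (Λ x) σ) : EReal) ≤ b) :
    (measuredQuasi α ρ σ : EReal) ≤ b := by
  have hb : 0 ≤ b := (EReal.coe_ennreal_nonneg _).trans (h 1 _ isPOVM_one)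
  rw [← EReal.coe_toENNReal hb]
  refine EReal.coe_ennreal_le_coe_ennreal_iff.2 ?_
  rw [measuredQuasi, if_neg h1.not_gt]
  refine iSup_le fun k => iSup_le fun Λ => iSup_le fun hΛ => ?_
  simpa using EReal.toENNReal_le_toENNReal (h k Λ hΛ)

/-- Exchanging the two arguments exchanges `α` and `1 - α`. -/
lemma measuredQuasi_swap {α : ℝ} (h0 : 0 < α) (h1 : α < 1) (ρ σ : CMat d) :
    measuredQuasi α ρ σ = measuredQuasi (1 - α) σ ρ := by
  simp only [measuredQuasi, if_pos h1, if_pos (by linarith : 1 - α < 1), classicalQuasi,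
    sub_sub_cancel, mul_comm]

lemma coe_classicalQuasi_of_lt_one {α : ℝ} (h0 : 0 < α) (h1 : α < 1) {k : ℕ} {p q : Fin k → ℝ}
    (hp : ∀ x, 0 ≤ p x) (hq : ∀ x, 0 ≤ q x) :
    (classicalQuasi α p q : EReal) = ((∑ x, p x ^ α * q x ^ (1 - α) : ℝ) : EReal) := by
  have hnn : ∀ x, 0 ≤ p x ^ α * q x ^ (1 - α) := fun x =>
    mul_nonneg (Real.rpow_nonneg (hp x) _) (Real.rpow_nonneg (hq x) _)
  have h : classicalQuasi α p q = ENNReal.ofReal (∑ x, p x ^ α * q x ^ (1 - α)) := by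
    rw [classicalQuasi, ENNReal.ofReal_sum_of_nonneg fun x _ => hnn x]
    refine Finset.sum_congr rfl fun x _ => ?_
    rw [ENNReal.ofReal_rpow_of_nonneg (hp x) h0.le,
      ENNReal.ofReal_rpow_of_nonneg (hq x) (by linarith),
      ENNReal.ofReal_mul (Real.rpow_nonneg (hp x) _)]
  rw [h, EReal.coe_ennreal_ofReal, max_eq_left (Finset.sum_nonneg fun x _ => hnn x)]

/-! ### Variational formulas with one variable -/

lemma measuredQuasi_le_of_posDef {α : ℝ} (h0 : 0 < α) (h1 : α < 1) {ρ σ ω : CMat d}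
    (hρ : ρ.PosSemidef) (hσ : σ.PosSemidef) (hω : ω.PosDef) :
    (measuredQuasi α ρ σ : EReal) ≤
      ((α * trProd ω ρ + (1 - α) * trProd (matPow ω (α / (α - 1))) σ : ℝ) : EReal) := by
  obtain ⟨Λ, hΛ, hf⟩ := exists_spectral_povm hω.1
  refine (EReal.coe_ennreal_le_coe_ennreal_iff.2 (measuredQuasi_le_classicalQuasi h1 hΛ)).trans ?_
  rw [coe_classicalQuasi_of_lt_one h0 h1 (fun x => trProd_nonneg (hΛ.1 x) hρ)
    (fun x => trProd_nonneg (hΛ.1 x) hσ), EReal.coe_le_coe_iff]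
  have e1 : trProd ω ρ = ∑ i, hω.1.eigenvalues i * trProd (Λ i) ρ := by
    have h := hf fun x => x
    rw [show cfc (fun x : ℝ => x) ω = ω from cfc_id' ℝ ω hω.1] at h
    conv_lhs => rw [h]
    simp only [trProd_sum_left, trProd_smul_left]
  have e2 : trProd (matPow ω (α / (α - 1))) σ =
      ∑ i, hω.1.eigenvalues i ^ (α / (α - 1)) * trProd (Λ i) σ := by
    rw [matPow, hf]
    simp only [trProd_sum_left, trProd_smul_left]
  rw [e1, e2, Finset.mul_sum, Finset.mul_sum, ← Finset.sum_add_distrib]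
  exact Finset.sum_le_sum fun i _ => young_of_lt_one h0 h1 (hω.eigenvalues_pos i)
    (trProd_nonneg (hΛ.1 i) hρ) (trProd_nonneg (hΛ.1 i) hσ)

/-- For `α ≤ 1 / 2` the exponent `α / (α - 1)` lies in `[-1, 0)`, where the power functions are
operator convex. -/
theorem measuredQuasi_eq_iInf_posDef {α : ℝ} (h0 : 0 < α) (h1 : α ≤ 1 / 2) {ρ σ : CMat d}
    (hρ : ρ.PosSemidef) (hσ : σ.PosSemidef) :
    (measuredQuasi α ρ σ : EReal) = ⨅ (ω : CMat d) (_ : ω.PosDef),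
      ((α * trProd ω ρ + (1 - α) * trProd (matPow ω (α / (α - 1))) σ : ℝ) : EReal) := by
  have h1' : α < 1 := by linarith
  refine le_antisymm
    (le_iInf fun ω => le_iInf fun hω => measuredQuasi_le_of_posDef h0 h1' hρ hσ hω)
    (le_measuredQuasi h1' fun k Λ hΛ => ?_)
  rw [coe_classicalQuasi_of_lt_one h0 h1' (fun x => trProd_nonneg (hΛ.1 x) hρ)
    (fun x => trProd_nonneg (hΛ.1 x) hσ)]
  refine le_coe_of_forall_pos (K := k) fun ε hε => ?_
  choose c hc hle using fun x => exists_young_of_lt_one h0 h1' (trProd_nonneg (hΛ.1 x) hρ)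
    (trProd_nonneg (hΛ.1 x) hσ) hε
  refine iInf_le_of_le (∑ x, c x • Λ x) (iInf_le_of_le (posDef_sum_smul hΛ hc) ?_)
  rw [EReal.coe_le_coe_iff]
  have e : α / (α - 1) = -(α / (1 - α)) := by rw [← div_neg, neg_sub]
  have hJ := trProd_mono_left (matPow_neg_le_sum_rpow_smul hΛ hc (s := α / (1 - α))
    (div_nonneg h0.le (by linarith)) ((div_le_one (by linarith)).2 (by linarith))) hσ
  rw [← e] at hJ
  calc _ ≤ α * trProd (∑ x, c x • Λ x) ρ +
        (1 - α) * trProd (∑ x, (c x ^ (α / (α - 1))) • Λ x) σ := by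
        gcongr
    _ = ∑ x, (α * (c x * trProd (Λ x) ρ) +
        (1 - α) * (c x ^ (α / (α - 1)) * trProd (Λ x) σ)) := by
        simp only [trProd_sum_left, trProd_smul_left, Finset.mul_sum, Finset.sum_add_distrib]
    _ ≤ ∑ x, (trProd (Λ x) ρ ^ α * trProd (Λ x) σ ^ (1 - α) + ε) :=
        Finset.sum_le_sum fun x _ => hle x
    _ = _ := by simp [Finset.sum_add_distrib, mul_comm]

lemma le_measuredQuasi_of_posDef {α : ℝ} (h1 : 1 < α) {ρ σ ω : CMat d}
    (hρ : ρ.PosSemidef) (hσ : σ.PosSemidef) (hω : ω.PosDef) :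
    ((α * trProd (matPow ω (1 - 1 / α)) ρ + (1 - α) * trProd ω σ : ℝ) : EReal) ≤
      (measuredQuasi α ρ σ : EReal) := by
  have h0 : 0 < α := by linarith
  obtain ⟨Λ, hΛ, hf⟩ := exists_spectral_povm hω.1
  refine le_trans ?_
    (EReal.coe_ennreal_le_coe_ennreal_iff.2 (classicalQuasi_le_measuredQuasi h1 hΛ))
  have e1 : trProd ω σ = ∑ i, hω.1.eigenvalues i * trProd (Λ i) σ := by
    have h := hf fun x => x
    rw [show cfc (fun x : ℝ => x) ω = ω from cfc_id' ℝ ω hω.1] at h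
    conv_lhs => rw [h]
    simp only [trProd_sum_left, trProd_smul_left]
  have e2 : trProd (matPow ω (1 - 1 / α)) ρ =
      ∑ i, hω.1.eigenvalues i ^ (1 - 1 / α) * trProd (Λ i) ρ := by
    rw [matPow, hf]
    simp only [trProd_sum_left, trProd_smul_left]
  rw [e1, e2, Finset.mul_sum, Finset.mul_sum, ← Finset.sum_add_distrib]
  refine le_trans (le_trans (EReal.coe_le_coe_iff.2 (le_max_left _ 0))
    EReal.coe_ennreal_ofReal.ge) (EReal.coe_ennreal_le_coe_ennreal_iff.2 ?_)
  refine (Finset.le_sum_of_subadditive ENNReal.ofReal ENNReal.ofReal_zero.le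
    (fun _ _ => ENNReal.ofReal_add_le) Finset.univ _).trans (Finset.sum_le_sum fun i _ => ?_)
  have hp := trProd_nonneg (hΛ.1 i) hρ
  beta_reduce
  rcases (trProd_nonneg (hΛ.1 i) hσ).eq_or_lt with hq | hq
  · rw [← hq, ENNReal.ofReal_zero, ENNReal.zero_rpow_of_neg (by linarith)]
    rcases hp.eq_or_lt with hp | hp
    · simp [← hp]
    · rw [ENNReal.mul_top (by simp [ENNReal.rpow_eq_zero_iff, hp])]
      exact le_top
  · rw [ENNReal.ofReal_rpow_of_nonneg hp h0.le, ENNReal.ofReal_rpow_of_pos hq,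
      ← ENNReal.ofReal_mul (Real.rpow_nonneg hp _)]
    exact ENNReal.ofReal_le_ofReal (young_of_one_lt h1 (hω.eigenvalues_pos i) hp hq)

/-- For `α > 1` the exponent `1 - 1 / α` lies in `(0, 1)`, where the power functions are operator
concave. -/
theorem measuredQuasi_eq_iSup_posDef {α : ℝ} (h1 : 1 < α) {ρ σ : CMat d}
    (hρ : ρ.PosSemidef) (hσ : σ.PosSemidef) :
    (measuredQuasi α ρ σ : EReal) = ⨆ (ω : CMat d) (_ : ω.PosDef),
      ((α * trProd (matPow ω (1 - 1 / α)) ρ + (1 - α) * trProd ω σ : ℝ) : EReal) := by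
  have h0 : 0 < α := by linarith
  have hs0 : 0 < 1 - 1 / α := sub_pos.2 ((div_lt_one h0).2 h1)
  have hs1 : 1 - 1 / α ≤ 1 := by
    have : 0 < 1 / α := by positivity
    linarith
  refine le_antisymm (measuredQuasi_le h1 fun k Λ hΛ => ?_)
    (iSup_le fun ω => iSup_le fun hω => le_measuredQuasi_of_posDef h1 hρ hσ hω)
  set p := fun x => trProd (Λ x) ρ
  set q := fun x => trProd (Λ x) σ
  have hp : ∀ x, 0 ≤ p x := fun x => trProd_nonneg (hΛ.1 x) hρ
  have hq : ∀ x, 0 ≤ q x := fun x => trProd_nonneg (hΛ.1 x) hσ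
  have hJ : ∀ c : Fin k → ℝ, (∀ x, 0 < c x) →
      ((∑ x, (α * (c x ^ (1 - 1 / α) * p x) + (1 - α) * (c x * q x)) : ℝ) : EReal) ≤
        ⨆ (ω : CMat d) (_ : ω.PosDef),
          ((α * trProd (matPow ω (1 - 1 / α)) ρ + (1 - α) * trProd ω σ : ℝ) : EReal) := by
    intro c hc
    refine le_iSup_of_le (∑ x, c x • Λ x) (le_iSup_of_le (posDef_sum_smul hΛ hc) ?_)
    rw [EReal.coe_le_coe_iff]
    have h := mul_le_mul_of_nonneg_left
      (trProd_mono_left (sum_rpow_smul_le_matPow hΛ hc hs0.le hs1) hρ) h0.le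
    simp only [trProd_sum_left, trProd_smul_left, Finset.mul_sum] at h ⊢
    rw [Finset.sum_add_distrib]
    linarith
  by_cases hsupp : ∀ x, q x = 0 → p x = 0
  · have hcl : classicalQuasi α p q = ENNReal.ofReal (∑ x, p x ^ α * q x ^ (1 - α)) := by
      rw [classicalQuasi, ENNReal.ofReal_sum_of_nonneg fun x _ =>
        mul_nonneg (Real.rpow_nonneg (hp x) _) (Real.rpow_nonneg (hq x) _)]
      refine Finset.sum_congr rfl fun x _ => ?_
      rcases (hq x).eq_or_lt with h | h
      · simp [hsupp x h.symm, h0, h0.ne']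
      · rw [ENNReal.ofReal_rpow_of_nonneg (hp x) h0.le, ENNReal.ofReal_rpow_of_pos h,
          ← ENNReal.ofReal_mul (Real.rpow_nonneg (hp x) _)]
    rw [hcl, EReal.coe_ennreal_ofReal, max_eq_left (Finset.sum_nonneg fun x _ =>
        mul_nonneg (Real.rpow_nonneg (hp x) _) (Real.rpow_nonneg (hq x) _))]
    refine coe_le_of_forall_pos (K := -k) fun ε hε => ?_
    choose c hc hle using fun x => exists_young_of_one_lt h1 (hp x) (hq x) (hsupp x) hε
    refine le_trans (EReal.coe_le_coe_iff.2 ?_) (hJ c hc)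
    refine le_trans (le_of_eq ?_) (Finset.sum_le_sum fun x _ => hle x)
    rw [Finset.sum_sub_distrib]
    simp [mul_comm, sub_eq_add_neg]
  -- An outcome with `p x > 0 = q x` makes both sides infinite: its coefficient tends to infinity.
  · push Not at hsupp
    obtain ⟨x₀, hq0, hp0⟩ := hsupp
    refine le_of_le_of_eq le_top (Eq.symm ?_)
    rw [EReal.eq_top_iff_forall_lt]
    intro M
    set R := ∑ x ∈ Finset.univ.erase x₀, (α * p x + (1 - α) * q x) with hR
    have hp0' : 0 < p x₀ := (hp x₀).lt_of_ne' hp0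
    have hlim : Tendsto (fun c : ℝ => α * (c ^ (1 - 1 / α) * p x₀) + R) atTop atTop :=
      tendsto_atTop_add_const_right _ _
        (((tendsto_rpow_atTop hs0).atTop_mul_const hp0').const_mul_atTop h0)
    obtain ⟨c, hcM, hc0⟩ :=
      ((hlim.eventually_gt_atTop M).and (eventually_gt_atTop 0)).exists
    refine lt_of_lt_of_le (EReal.coe_lt_coe_iff.2 hcM) (le_trans (EReal.coe_le_coe_iff.2 ?_)
      (hJ (fun x => if x = x₀ then c else 1) fun x => by split_ifs <;> simp [hc0]))
    rw [← Finset.add_sum_erase _ _ (Finset.mem_univ x₀)]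
    refine add_le_add (by simp [hq0]) (le_of_eq (Finset.sum_congr rfl fun x hx => ?_))
    simp [Finset.ne_of_mem_erase hx]

/-! ### Variational formulas with two variables -/

lemma geoMean_one_left (t : ℝ) (ω : CMat d) : geoMean t 1 ω = matPow ω t := by
  simp [geoMean, one_matPow]

theorem measuredQuasi_eq_iInf {α : ℝ} (h0 : 0 < α) (h1 : α ≤ 1 / 2) {ρ σ : CMat d}
    (hρ : ρ.PosSemidef) (hσ : σ.PosSemidef) :
    (measuredQuasi α ρ σ : EReal) = ⨅ (ω : CMat d) (θ : CMat d)
      (_ : ω.PosDef ∧ θ.PosDef ∧ (θ - geoMean (α / (α - 1)) 1 ω).PosSemidef),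
      ((α * trProd ω ρ + (1 - α) * trProd θ σ : ℝ) : EReal) := by
  refine le_antisymm (le_iInf fun ω => le_iInf fun θ => le_iInf fun h => ?_) ?_
  · refine (measuredQuasi_le_of_posDef h0 (by linarith) hρ hσ h.1).trans
      (EReal.coe_le_coe_iff.2 ?_)
    have h2 := h.2.2
    rw [geoMean_one_left] at h2
    have h3 := trProd_mono_left (le_iff_posSemidef.2 h2) hσ
    gcongr
    linarith
  · rw [measuredQuasi_eq_iInf_posDef h0 h1 hρ hσ]
    refine le_iInf fun ω => le_iInf fun hω => iInf_le_of_le ω (iInf_le_of_le _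
      (iInf_le_of_le ⟨hω, posDef_matPow hω _, ?_⟩ le_rfl))
    rw [geoMean_one_left, sub_self]
    exact Matrix.PosSemidef.zero

theorem measuredQuasi_eq_iSup {α : ℝ} (h1 : 1 < α) {ρ σ : CMat d}
    (hρ : ρ.PosSemidef) (hσ : σ.PosSemidef) :
    (measuredQuasi α ρ σ : EReal) = ⨆ (ω : CMat d) (θ : CMat d)
      (_ : ω.PosDef ∧ θ.PosDef ∧ (geoMean (1 - 1 / α) 1 ω - θ).PosSemidef),
      ((α * trProd θ ρ + (1 - α) * trProd ω σ : ℝ) : EReal) := by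
  refine le_antisymm ?_ (iSup_le fun ω => iSup_le fun θ => iSup_le fun h => ?_)
  · rw [measuredQuasi_eq_iSup_posDef h1 hρ hσ]
    refine iSup_le fun ω => iSup_le fun hω => le_iSup_of_le ω (le_iSup_of_le _
      (le_iSup_of_le ⟨hω, posDef_matPow hω _, ?_⟩ le_rfl))
    rw [geoMean_one_left, sub_self]
    exact Matrix.PosSemidef.zero
  · refine le_trans (EReal.coe_le_coe_iff.2 ?_) (le_measuredQuasi_of_posDef h1 hρ hσ h.1)
    have h2 := h.2.2
    rw [geoMean_one_left] at h2
    have h3 := trProd_mono_left (le_iff_posSemidef.2 h2) hρ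
    gcongr

end Variational

section SemidefinitePrograms

open scoped MatrixOrder
open Filter Topology

/-! ### Real coordinates for the matrix inequalities -/

/-- The inequalities of a list between powers, in real coordinates. The variables are the matrices
`v e` for the finitely many exponents `e ≠ 0` that occur, while `v 0 = 1` supplies the constant
terms. -/
lemma exists_lmiSystem (L : List (ℝ × ℝ)) {e₁ e₂ : ℝ} (h₁ : e₁ ≠ 0) (h₂ : e₂ ≠ 0) (d : ℕ) :
    ∃ (N : ℕ) (S : LMISystem N L.length (Fin d ⊕ Fin d)) (A B : Fin N → CMat d),
      (∀ i, (A i).IsHermitian) ∧ (∀ i, (B i).IsHermitian) ∧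
      (∀ y ∈ S.feasible, ∃ v : ℝ → CMat d, PowerSystem L v ∧ ∀ (ρ σ : CMat d) (a b : ℝ),
        ∑ i, (a * trProd (A i) ρ + b * trProd (B i) σ) * y i =
          a * trProd (v e₁) ρ + b * trProd (v e₂) σ) ∧
      (∀ v : ℝ → CMat d, PowerSystem L v → ∃ y ∈ S.feasible, ∀ (ρ σ : CMat d) (a b : ℝ),
        ∑ i, (a * trProd (A i) ρ + b * trProd (B i) σ) * y i =
          a * trProd (v e₁) ρ + b * trProd (v e₂) σ) := by
  classical
  set E : Finset ℝ := {e₁, e₂} ∪ (L.toFinset.image Prod.fst ∪ L.toFinset.image Prod.snd ∪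
    L.toFinset.image fun x => (x.1 + x.2) / 2) with hE
  set H := selfAdjoint.submodule ℝ (CMat d)
  let lin : ℝ → (E → H) →ₗ[ℝ] CMat d := fun e =>
    if h : e ∈ E ∧ e ≠ 0 then H.subtype ∘ₗ LinearMap.proj (⟨e, h.1⟩ : E) else 0
  let con : ℝ → CMat d := fun e => if e = 0 then 1 else 0
  have lin_zero : lin 0 = 0 := dif_neg (by simp)
  have lin_apply : ∀ {e : ℝ} (he : e ∈ E), e ≠ 0 → ∀ w, lin e w = (w ⟨e, he⟩ : CMat d) := by
    intro e he h0 w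
    simp [lin, he, h0]
  have hlin : ∀ e w, (lin e w).IsHermitian := by
    intro e w
    by_cases h : e ∈ E ∧ e ≠ 0
    · rw [lin_apply h.1 h.2]
      exact (w ⟨e, h.1⟩).2
    · have : lin e = 0 := dif_neg h
      rw [this]
      exact Matrix.isHermitian_zero
  have hcon : ∀ e, (con e).IsHermitian := by
    intro e
    by_cases h : e = 0 <;> simp [con, h]
  have con_ne : ∀ {e : ℝ}, e ≠ 0 → con e = 0 := fun h => if_neg h
  have hblock : ∀ {M₁ M₂ M₃ : CMat d}, M₁.IsHermitian → M₂.IsHermitian → M₃.IsHermitian →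
      (Matrix.fromBlocks M₁ M₂ M₂ M₃).IsHermitian := fun g₁ g₂ g₃ =>
    Matrix.IsHermitian.fromBlocks g₁ g₂.eq g₃
  let bas := Module.finBasis ℝ (E → H)
  let S : LMISystem (Module.finrank ℝ (E → H)) L.length (Fin d ⊕ Fin d) :=
    { F₀ := fun j => Matrix.fromBlocks (con (L.get j).1) (con (((L.get j).1 + (L.get j).2) / 2))
        (con (((L.get j).1 + (L.get j).2) / 2)) (con (L.get j).2)
      F := fun j i => Matrix.fromBlocks (lin (L.get j).1 (bas i))
        (lin (((L.get j).1 + (L.get j).2) / 2) (bas i))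
        (lin (((L.get j).1 + (L.get j).2) / 2) (bas i)) (lin (L.get j).2 (bas i))
      isHermitian_F₀ := fun j => hblock (hcon _) (hcon _) (hcon _)
      isHermitian_F := fun j i => hblock (hlin _ _) (hlin _ _) (hlin _ _) }
  have hlinsum : ∀ e w, lin e w = ∑ i, bas.equivFun w i • lin e (bas i) := by
    intro e w
    conv_lhs => rw [← bas.sum_equivFun w]
    simp only [map_sum, map_smul]
  have hS : ∀ w j, S.F₀ j + ∑ i, ((bas.equivFun w i : ℝ) : ℂ) • S.F j i =
      Matrix.fromBlocks (con (L.get j).1 + lin (L.get j).1 w)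
        (con (((L.get j).1 + (L.get j).2) / 2) + lin (((L.get j).1 + (L.get j).2) / 2) w)
        (con (((L.get j).1 + (L.get j).2) / 2) + lin (((L.get j).1 + (L.get j).2) / 2) w)
        (con (L.get j).2 + lin (L.get j).2 w) := by
    intro w j
    rw [hlinsum _ w, hlinsum (((L.get j).1 + (L.get j).2) / 2) w, hlinsum (L.get j).2 w]
    ext i k
    rcases i with i | i <;> rcases k with k | k <;> simp [S, Matrix.sum_apply]
  have hobj : ∀ (w : E → H) (ρ σ : CMat d) (a b : ℝ),
      ∑ i, (a * trProd (lin e₁ (bas i)) ρ + b * trProd (lin e₂ (bas i)) σ) * bas.equivFun w i =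
        a * trProd (lin e₁ w) ρ + b * trProd (lin e₂ w) σ := by
    intro w ρ σ a b
    rw [hlinsum e₁ w, hlinsum e₂ w]
    simp only [trProd_sum_left, trProd_smul_left, Finset.mul_sum, ← Finset.sum_add_distrib]
    exact Finset.sum_congr rfl fun i _ => by ring
  have hmem₁ : e₁ ∈ E := by simp [hE]
  have hmem₂ : e₂ ∈ E := by simp [hE]
  refine ⟨_, S, fun i => lin e₁ (bas i), fun i => lin e₂ (bas i), fun i => hlin _ _,
    fun i => hlin _ _, fun y hy => ?_, fun v hv => ?_⟩
  · set w := bas.equivFun.symm y with hw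
    have hyw : y = bas.equivFun w := (bas.equivFun.apply_symm_apply y).symm
    refine ⟨fun e => con e + lin e w, ⟨by simp [con, lin_zero],
      fun e => (hcon e).add (hlin e w), fun ac hac => ?_⟩, fun ρ σ a b => ?_⟩
    · obtain ⟨j, rfl⟩ := List.get_of_mem hac
      have := hy j
      rwa [hyw, hS] at this
    · beta_reduce
      rw [con_ne h₁, con_ne h₂, zero_add, zero_add, hyw]
      exact hobj w ρ σ a b
  · set w : E → H := fun e => ⟨v e, hv.isHermitian e⟩ with hw
    have hval : ∀ e ∈ E, con e + lin e w = v e := by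
      intro e he
      by_cases h : e = 0
      · subst h
        simp [con, lin_zero, hv.zero_eq_one]
      · rw [con_ne h, lin_apply he h, zero_add]
    have hval' : ∀ e ∈ E, e ≠ 0 → lin e w = v e := fun e he h => by
      rw [lin_apply he h]
    refine ⟨bas.equivFun w, fun j => ?_, fun ρ σ a b => ?_⟩
    · have hj : L.get j ∈ L := List.get_mem L j
      have m₁ : (L.get j).1 ∈ E := by
        rw [hE]
        simp only [Finset.mem_union, Finset.mem_image, List.mem_toFinset]
        exact Or.inr (Or.inl (Or.inl ⟨_, hj, rfl⟩))
      have m₂ : (L.get j).2 ∈ E := by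
        rw [hE]
        simp only [Finset.mem_union, Finset.mem_image, List.mem_toFinset]
        exact Or.inr (Or.inl (Or.inr ⟨_, hj, rfl⟩))
      have m₃ : ((L.get j).1 + (L.get j).2) / 2 ∈ E := by
        rw [hE]
        simp only [Finset.mem_union, Finset.mem_image, List.mem_toFinset]
        exact Or.inr (Or.inr ⟨_, hj, rfl⟩)
      rw [hS, hval _ m₁, hval _ m₂, hval _ m₃]
      exact hv.block _ hj
    · rw [hobj w ρ σ a b, hval' _ hmem₁ h₁, hval' _ hmem₂ h₂]

/-- A quantity that is the infimum (or the supremum) of a linear functional over the solutions of a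
list of inequalities between powers is the optimal value of a semidefinite program. -/
lemma exists_lmiSystem_value (L : List (ℝ × ℝ)) {e₁ e₂ : ℝ} (h₁ : e₁ ≠ 0) (h₂ : e₂ ≠ 0) (d : ℕ) :
    ∃ (N : ℕ) (S : LMISystem N L.length (Fin d ⊕ Fin d)) (A B : Fin N → CMat d),
      (∀ i, (A i).IsHermitian) ∧ (∀ i, (B i).IsHermitian) ∧ ∀ (ρ σ : CMat d) (a b : ℝ),
        S.minValue (fun i => a * trProd (A i) ρ + b * trProd (B i) σ) =
          ⨅ (v : ℝ → CMat d) (_ : PowerSystem L v),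
            ((a * trProd (v e₁) ρ + b * trProd (v e₂) σ : ℝ) : EReal) ∧
        S.maxValue (fun i => a * trProd (A i) ρ + b * trProd (B i) σ) =
          ⨆ (v : ℝ → CMat d) (_ : PowerSystem L v),
            ((a * trProd (v e₁) ρ + b * trProd (v e₂) σ : ℝ) : EReal) := by
  obtain ⟨N, S, A, B, hA, hB, hto, hfrom⟩ := exists_lmiSystem L h₁ h₂ d
  refine ⟨N, S, A, B, hA, hB, fun ρ σ a b => ⟨le_antisymm ?_ ?_, le_antisymm ?_ ?_⟩⟩
  · refine le_iInf₂ fun v hv => ?_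
    obtain ⟨y, hy, h⟩ := hfrom v hv
    exact iInf₂_le_of_le y hy (by rw [h])
  · refine le_iInf₂ fun y hy => ?_
    obtain ⟨v, hv, h⟩ := hto y hy
    exact iInf₂_le_of_le v hv (by rw [h])
  · refine iSup₂_le fun y hy => ?_
    obtain ⟨v, hv, h⟩ := hto y hy
    exact le_iSup₂_of_le v hv (by rw [h])
  · refine iSup₂_le fun v hv => ?_
    obtain ⟨y, hy, h⟩ := hfrom v hv
    exact le_iSup₂_of_le y hy (by rw [h])

/-! ### The measured quasi-entropy as a semidefinite program -/

/-- The pair `(s, -s)` turns an upper bound on the `s`-th power into a lower bound on the power of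
exponent `-s`. -/
lemma exists_powerList_iInf {α : ℝ} (h0 : 0 < α) (h1 : α ≤ 1 / 2) {n : ℕ}
    (hn : PowerBound (α / (1 - α)) n) :
    ∃ L : List (ℝ × ℝ), L.length ≤ n + 2 ∧ ∀ (d : ℕ) (ρ σ : CMat d), ρ.PosSemidef →
      σ.PosSemidef → (measuredQuasi α ρ σ : EReal) = ⨅ (v : ℝ → CMat d) (_ : PowerSystem L v),
        ((α * trProd (v 1) ρ + (1 - α) * trProd (v (α / (α - 1))) σ : ℝ) : EReal) := by
  obtain ⟨L, hL, hbound⟩ := hn 1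
  have es : α / (α - 1) = -(α / (1 - α)) := by rw [← div_neg, neg_sub]
  set s := α / (1 - α) with hs
  have hs0 : 0 ≤ s := div_nonneg h0.le (by linarith)
  have hs1 : s ≤ 1 := (div_le_one (by linarith)).2 (by linarith)
  refine ⟨(1, 1) :: (s, -s) :: L, by simpa using hL, fun d ρ σ hρ hσ => le_antisymm ?_ ?_⟩
  · refine le_iInf₂ fun v hv => le_coe_of_forall_pos (K := α * trProd 1 ρ) fun ε hε => ?_
    have hv1 : (v 1).PosSemidef := hv.posSemidef (by simp)
    have hpow := hbound d v (hv.mono fun x hx => by simp [hx]) hv1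
    have hblock := hv.block (s, -s) (by simp)
    have e : (s + -s) / 2 = 0 := by ring
    simp only [e, hv.zero_eq_one] at hblock
    rw [one_mul] at hpow
    -- The matrix `v 1` may be singular; it is replaced by `v 1 + ε`.
    have hY := posDef_add_smul_one hv1 hε
    have hθ := matPow_neg_le_of_block hY (hpow.trans (matPow_le_matPow
      (zero_le_iff_posSemidef.2 hv1) (self_le_add_smul_one hε.le) hs0 hs1)) hblock
    refine (measuredQuasi_le_of_posDef h0 (by linarith) hρ hσ hY).trans (EReal.coe_le_coe_iff.2 ?_)
    have h2 := mul_le_mul_of_nonneg_left (trProd_mono_left hθ hσ) (by linarith : 0 ≤ 1 - α)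
    rw [es, trProd_add_left, trProd_smul_left]
    linarith
  · rw [measuredQuasi_eq_iInf_posDef h0 h1 hρ hσ]
    refine le_iInf₂ fun ω hω => iInf₂_le_of_le _ (powerSystem_matPow _ hω) ?_
    rw [matPow_one hω.1]

lemma exists_powerList_iSup {α : ℝ} (h1 : 1 < α) {n : ℕ} (hn : PowerBound (1 - 1 / α) n) :
    ∃ L : List (ℝ × ℝ), L.length ≤ n + 1 ∧ ∀ (d : ℕ) (ρ σ : CMat d), ρ.PosSemidef →
      σ.PosSemidef → (measuredQuasi α ρ σ : EReal) = ⨆ (v : ℝ → CMat d) (_ : PowerSystem L v),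
        ((α * trProd (v (1 - 1 / α)) ρ + (1 - α) * trProd (v 1) σ : ℝ) : EReal) := by
  have h0 : 0 < α := by linarith
  obtain ⟨L, hL, hbound⟩ := hn 1
  have hs0 : 0 ≤ 1 - 1 / α := sub_nonneg.2 ((div_le_one h0).2 h1.le)
  have hs1 : 1 - 1 / α ≤ 1 := by
    have : 0 < 1 / α := by positivity
    linarith
  refine ⟨(1, 1) :: L, by simpa using hL, fun d ρ σ hρ hσ => le_antisymm ?_ ?_⟩
  · rw [measuredQuasi_eq_iSup_posDef h1 hρ hσ]
    refine iSup₂_le fun ω hω => le_iSup₂_of_le _ (powerSystem_matPow _ hω) ?_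
    rw [matPow_one hω.1]
  · refine iSup₂_le fun v hv => coe_le_of_forall_pos (K := (1 - α) * trProd 1 σ) fun ε hε => ?_
    have hv1 : (v 1).PosSemidef := hv.posSemidef (by simp)
    have hpow := hbound d v (hv.mono fun x hx => by simp [hx]) hv1
    rw [one_mul] at hpow
    have hY := posDef_add_smul_one hv1 hε
    have hθ := hpow.trans (matPow_le_matPow (zero_le_iff_posSemidef.2 hv1)
      (self_le_add_smul_one hε.le) hs0 hs1)
    refine le_trans (EReal.coe_le_coe_iff.2 ?_) (le_measuredQuasi_of_posDef h1 hρ hσ hY)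
    have h2 := mul_le_mul_of_nonneg_left (trProd_mono_left hθ hρ) h0.le
    rw [trProd_add_left, trProd_smul_left]
    linarith

lemma powerBound_of_eq_div {s : ℝ} (hs0 : 0 ≤ s) (hs1 : s ≤ 1) {p : ℤ} {q : ℕ} (hq : 0 < q)
    (h : (p : ℝ) / q = s) : PowerBound s (3 * Nat.log 2 q + 3) := by
  have hqr : (0 : ℝ) < q := by exact_mod_cast hq
  have hp : (p : ℝ) = s * q := by rw [← h]; field_simp
  have hp0 : 0 ≤ p := by
    have : (0 : ℝ) ≤ p := by rw [hp]; positivity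
    exact_mod_cast this
  obtain ⟨m, rfl⟩ := Int.eq_ofNat_of_zero_le hp0
  have hm : m ≤ q := by
    have : (m : ℝ) ≤ q := by
      have h2 : (m : ℝ) = s * q := by exact_mod_cast hp
      rw [h2]
      exact mul_le_of_le_one_left hqr.le hs1
    exact_mod_cast this
  have := powerBound_div hq hm
  rw [← h]
  simpa using this

lemma length_le_logb {q n : ℕ} (hn : n ≤ 3 * Nat.log 2 q + 3 + 2) :
    (n : ℝ) ≤ 5 * (1 + Real.logb 2 q) := by
  have h1 : (Nat.log 2 q : ℝ) ≤ Real.logb 2 q := by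
    exact_mod_cast Real.natLog_le_logb q 2
  have h2 : (n : ℝ) ≤ 3 * Nat.log 2 q + 3 + 2 := by exact_mod_cast hn
  have h3 : (0 : ℝ) ≤ Nat.log 2 q := Nat.cast_nonneg _
  linarith

end SemidefinitePrograms

theorem proposition3 :
    (∀ (d : ℕ) (ρ σ : CMat d), IsState ρ → σ.PosSemidef →
      (∀ α : ℝ, 0 < α → α < 1 / 2 →
        (measuredQuasi α ρ σ : EReal) =
          ⨅ (ω : CMat d) (θ : CMat d)
            (_ : ω.PosDef ∧ θ.PosDef ∧ (θ - geoMean (α / (α - 1)) 1 ω).PosSemidef),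
            ((α * trProd ω ρ + (1 - α) * trProd θ σ : ℝ) : EReal)) ∧
      (∀ α : ℝ, 1 / 2 ≤ α → α < 1 →
        (measuredQuasi α ρ σ : EReal) =
          ⨅ (ω : CMat d) (θ : CMat d)
            (_ : ω.PosDef ∧ θ.PosDef ∧ (θ - geoMean (1 - 1 / α) 1 ω).PosSemidef),
            ((α * trProd θ ρ + (1 - α) * trProd ω σ : ℝ) : EReal)) ∧
      (∀ α : ℝ, 1 < α →
        (measuredQuasi α ρ σ : EReal) =
          ⨆ (ω : CMat d) (θ : CMat d)
            (_ : ω.PosDef ∧ θ.PosDef ∧ (geoMean (1 - 1 / α) 1 ω - θ).PosSemidef),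
            ((α * trProd θ ρ + (1 - α) * trProd ω σ : ℝ) : EReal))) ∧
    (∃ C : ℝ, ∀ (α : ℚ) (p : ℤ) (q : ℕ), 0 < α → α ≠ 1 → 0 < q → IsCoprime p (q : ℤ) →
      (p : ℚ) / (q : ℚ) = (if α < 1 / 2 then α / (α - 1) else 1 - 1 / α) →
      ∀ d : ℕ, ∃ (N m : ℕ) (S : LMISystem N m (Fin d ⊕ Fin d)) (A B : Fin N → CMat d),
        (m : ℝ) ≤ C * (1 + Real.logb 2 q) ∧
        (∀ i, (A i).IsHermitian) ∧ (∀ i, (B i).IsHermitian) ∧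
        ∀ ρ σ : CMat d, IsState ρ → σ.PosSemidef →
          (measuredQuasi (α : ℝ) ρ σ : EReal) =
            if α < 1 then
              S.minValue (fun i => (α : ℝ) * trProd (A i) ρ + (1 - (α : ℝ)) * trProd (B i) σ)
            else
              S.maxValue (fun i => (α : ℝ) * trProd (A i) ρ + (1 - (α : ℝ)) * trProd (B i) σ)) := by
  -- Under `α ↦ 1 - α` the exponent `α / (α - 1)` becomes `1 - 1 / α`.
  have hexp : ∀ α : ℝ, 0 < α → (1 - α) / (1 - α - 1) = 1 - 1 / α := by
    intro α h0
    have : 1 - α - 1 ≠ 0 := by linarith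
    rw [div_eq_iff this]
    field_simp
    ring
  refine ⟨fun d ρ σ hρ hσ => ⟨fun α h0 h1 => measuredQuasi_eq_iInf h0 h1.le hρ.1 hσ,
    fun α h0 h1 => ?_, fun α h1 => measuredQuasi_eq_iSup h1 hρ.1 hσ⟩, 5, ?_⟩
  · rw [measuredQuasi_swap (by linarith) h1,
      measuredQuasi_eq_iInf (by linarith) (by linarith) hσ hρ.1, hexp α (by linarith)]
    simp only [sub_sub_cancel, add_comm]
  · intro α p q hα0 hα1 hq _ hpq d
    have h0 : (0 : ℝ) < α := by exact_mod_cast hα0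
    rcases lt_or_gt_of_ne hα1 with hlt | hgt
    · have h1 : (α : ℝ) < 1 := by exact_mod_cast hlt
      simp only [if_pos hlt]
      by_cases hhalf : α < 1 / 2
      · have h2 : (α : ℝ) < 1 / 2 := by
          have := (Rat.cast_lt (K := ℝ)).2 hhalf
          simpa using this
        rw [if_pos hhalf] at hpq
        have hs : ((-p : ℤ) : ℝ) / q = (α : ℝ) / (1 - α) := by
          have := congrArg (Rat.cast (K := ℝ)) hpq
          push_cast at this ⊢
          rw [neg_div, this, ← div_neg, neg_sub]
        obtain ⟨L, hL, hval⟩ := exists_powerList_iInf h0 h2.le (powerBound_of_eq_div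
          (div_nonneg h0.le (by linarith)) ((div_le_one (by linarith)).2 (by linarith)) hq hs)
        obtain ⟨N, S, A, B, hA, hB, hS⟩ := exists_lmiSystem_value L one_ne_zero
          (div_ne_zero h0.ne' (by linarith) : (α : ℝ) / (α - 1) ≠ 0) d
        refine ⟨N, _, S, A, B, length_le_logb hL, hA, hB, fun ρ σ hρ hσ => ?_⟩
        rw [hval d ρ σ hρ.1 hσ, (hS ρ σ _ _).1]
      · have h2 : (1 : ℝ) / 2 ≤ α := by
          have := (Rat.cast_le (K := ℝ)).2 (not_lt.1 hhalf)
          simpa using this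
        rw [if_neg hhalf] at hpq
        have hs : ((-p : ℤ) : ℝ) / q = (1 - α : ℝ) / (1 - (1 - α)) := by
          have := congrArg (Rat.cast (K := ℝ)) hpq
          push_cast at this ⊢
          rw [neg_div, this, ← hexp α h0, ← div_neg, neg_sub]
        obtain ⟨L, hL, hval⟩ := exists_powerList_iInf (α := 1 - α) (by linarith) (by linarith)
          (powerBound_of_eq_div (div_nonneg (by linarith) (by linarith))
            ((div_le_one (by linarith)).2 (by linarith)) hq hs)
        obtain ⟨N, S, A, B, hA, hB, hS⟩ := exists_lmiSystem_value L
          (div_ne_zero (by linarith) (by linarith) : (1 - α : ℝ) / (1 - α - 1) ≠ 0) one_ne_zero d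
        refine ⟨N, _, S, A, B, length_le_logb hL, hA, hB, fun ρ σ hρ hσ => ?_⟩
        rw [measuredQuasi_swap h0 h1, hval d σ ρ hσ hρ.1, (hS ρ σ _ _).1]
        simp only [sub_sub_cancel, add_comm]
    · have h1 : (1 : ℝ) < α := by exact_mod_cast hgt
      have hhalf : ¬ α < 1 / 2 := by linarith
      simp only [if_neg hgt.not_gt]
      rw [if_neg hhalf] at hpq
      have hs : (p : ℝ) / q = 1 - 1 / (α : ℝ) := by
        have := congrArg (Rat.cast (K := ℝ)) hpq
        push_cast at this ⊢
        exact this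
      have hs0 : (0 : ℝ) < 1 - 1 / α := sub_pos.2 ((div_lt_one h0).2 h1)
      have hs1 : (1 : ℝ) - 1 / α ≤ 1 := by
        have : 0 < 1 / (α : ℝ) := by positivity
        linarith
      obtain ⟨L, hL, hval⟩ := exists_powerList_iSup h1 (powerBound_of_eq_div hs0.le hs1 hq hs)
      obtain ⟨N, S, A, B, hA, hB, hS⟩ := exists_lmiSystem_value L hs0.ne' one_ne_zero d
      refine ⟨N, _, S, A, B, length_le_logb (hL.trans (Nat.le_succ _)), hA, hB,
        fun ρ σ hρ hσ => ?_⟩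
      rw [hval d ρ σ hρ.1 hσ, (hS ρ σ _ _).2]
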